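/- There is an algorithm that, given a finite simple graph $G$ with $m$ edges and two nonnegative integers $k$ and $w$, decides in time $O(m + 2^k\, k!\, k^4)$ whether there is a bijection $\sigma : V(G) \to \{1, \dots, |V(G)|\}$ with \[ \min(\sigma(u),\sigma(v)) \le k \ \text{ for every edge } uv \in E(G), \qquad \sum_{uv \in E(G)} \min(\sigma(u), \sigma(v)) \le w . \] More precisely, there are a single program for a random access machine and constants $a$ and $C$ such that for every such input, with the vertices of $G$ numbered $0, \dots, n-1$ and its edges given as a list (each edge once, in an arbitrary order), the program halts with the correct answer after at most $C\,(m + 2^k\, k!\, k^4 + 1)$ steps, and all numbers that it writes are smaller than $(n + m + k + w + 2)^a$, so that they fit into machine words of $O(\log(n+m+k+w+2))$ bits. -/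

import Mathlib

/-! ## Minimum sum vertex cover -/

namespace MinSumVC

variable {V : Type*} [Fintype V]

/-- A solution numbers the vertices by `1, …, |V|`; `Fin (Fintype.card V)` starts at `0`, so the
position of a vertex is one more than its image. -/
abbrev Solution (V : Type*) [Fintype V] : Type _ := V ≃ Fin (Fintype.card V)

/-- The position `σ(v) ∈ {1, …, |V|}` of the vertex `v`. -/
def position (σ : Solution V) (v : V) : ℕ := (σ v : ℕ) + 1

/-- The cost `min (σ(u), σ(v))` of the edge `uv`. -/
def edgeCost (σ : Solution V) : Sym2 V → ℕ :=
  Sym2.lift ⟨fun u v => min (position σ u) (position σ v), fun _ _ => min_comm _ _⟩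

/-- The maximum cost of an edge (`0` if the graph has no edges). -/
def maxCost (G : SimpleGraph V) [Fintype G.edgeSet] (σ : Solution V) : ℕ :=
  G.edgeFinset.sup (edgeCost σ)

/-- The sum of the costs of all edges. -/
def totalCost (G : SimpleGraph V) [Fintype G.edgeSet] (σ : Solution V) : ℕ :=
  ∑ e ∈ G.edgeFinset, edgeCost σ e

/-- `(G, w, k)` is a yes-instance: some solution has maximum cost at most `k` and total cost
at most `w`. -/
def YesInstance (G : SimpleGraph V) [Fintype G.edgeSet] (k w : ℕ) : Prop :=
  ∃ σ : Solution V, maxCost G σ ≤ k ∧ totalCost G σ ≤ w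

end MinSumVC

/-! ## Random access machines with a step count

A machine has registers and a memory, each indexed by `ℕ`. Programs are finite and built from
elementary instructions by sequencing, conditionals and loops. Every elementary
instruction and every evaluation of a test takes one step. All numbers that are written have to
be smaller than a bound `B`, i.e. they have to fit into a machine word. -/

namespace RAM

/-- The contents of the registers and of the memory. -/
structure State where
  reg : ℕ → ℕ
  mem : ℕ → ℕ

/-- Write `a` into register `x`. -/
def State.setReg (s : State) (x a : ℕ) : State :=
  { s with reg := Function.update s.reg x a }

/-- Write `a` into the memory cell with address `i`. -/
def State.setMem (s : State) (i a : ℕ) : State :=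
  { s with mem := Function.update s.mem i a }

/-- The arithmetic operations of the machine (subtraction is truncated at `0`). -/
inductive Op where
  | add
  | sub
  | mul

/-- The value of an arithmetic operation. -/
def Op.eval : Op → ℕ → ℕ → ℕ
  | .add, a, b => a + b
  | .sub, a, b => a - b
  | .mul, a, b => a * b

/-- The tests of the machine compare two registers. -/
inductive Test where
  | lt (x y : ℕ)
  | eq (x y : ℕ)

/-- The test succeeds in the given state. -/
def Test.Holds : Test → State → Prop
  | .lt x y, s => s.reg x < s.reg y
  | .eq x y, s => s.reg x = s.reg y

/-- Programs. Here `x`, `y`, `z` are names of registers and `c` is a constant. -/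
inductive Prog where
  /-- do nothing -/
  | skip
  /-- `x := c` -/
  | const (x c : ℕ)
  /-- `x := y` -/
  | copy (x y : ℕ)
  /-- `x := y ∘ z` -/
  | arith (o : Op) (x y z : ℕ)
  /-- `x := mem[y]` -/
  | load (x y : ℕ)
  /-- `mem[x] := y` -/
  | store (x y : ℕ)
  /-- first `p`, then `q` -/
  | seq (p q : Prog)
  /-- `if b then p else q` -/
  | ite (b : Test) (p q : Prog)
  /-- `while b do p` -/
  | loop (b : Test) (p : Prog)

/-- `Exec B p s s' t`: started in the state `s`, the program `p` halts in the state `s'` after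
exactly `t` steps, and each number that it writes is smaller than `B`. -/
inductive Exec (B : ℕ) : Prog → State → State → ℕ → Prop where
  | skip (s : State) : Exec B .skip s s 1
  | const (s : State) (x c : ℕ) (h : c < B) : Exec B (.const x c) s (s.setReg x c) 1
  | copy (s : State) (x y : ℕ) (h : s.reg y < B) :
      Exec B (.copy x y) s (s.setReg x (s.reg y)) 1
  | arith (s : State) (o : Op) (x y z : ℕ) (h : o.eval (s.reg y) (s.reg z) < B) :
      Exec B (.arith o x y z) s (s.setReg x (o.eval (s.reg y) (s.reg z))) 1
  | load (s : State) (x y : ℕ) (h : s.mem (s.reg y) < B) :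
      Exec B (.load x y) s (s.setReg x (s.mem (s.reg y))) 1
  | store (s : State) (x y : ℕ) (hx : s.reg x < B) (hy : s.reg y < B) :
      Exec B (.store x y) s (s.setMem (s.reg x) (s.reg y)) 1
  | seq {p q : Prog} {s s' s'' : State} {t t' : ℕ} (hp : Exec B p s s' t)
      (hq : Exec B q s' s'' t') : Exec B (.seq p q) s s'' (t + t')
  | iteTrue {b : Test} {p q : Prog} {s s' : State} {t : ℕ} (hb : b.Holds s)
      (hp : Exec B p s s' t) : Exec B (.ite b p q) s s' (t + 1)
  | iteFalse {b : Test} {p q : Prog} {s s' : State} {t : ℕ} (hb : ¬ b.Holds s)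
      (hq : Exec B q s s' t) : Exec B (.ite b p q) s s' (t + 1)
  | loopStop {b : Test} {p : Prog} {s : State} (hb : ¬ b.Holds s) : Exec B (.loop b p) s s 1
  | loopStep {b : Test} {p : Prog} {s s' s'' : State} {t t' : ℕ} (hb : b.Holds s)
      (hp : Exec B p s s' t) (hl : Exec B (.loop b p) s' s'' t') :
      Exec B (.loop b p) s s'' (t + t' + 1)

/-- The machine is deterministic: the final state and the number of steps are unique. -/
theorem Exec.deterministic {B : ℕ} {p : Prog} {s s₁ : State} {t₁ : ℕ} (h₁ : Exec B p s s₁ t₁) :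
    ∀ {s₂ : State} {t₂ : ℕ}, Exec B p s s₂ t₂ → s₁ = s₂ ∧ t₁ = t₂ := by
  induction h₁ with
  | seq _ _ ihp ihq =>
    intro s₂ t₂ h
    cases h with
    | seq hp hq =>
      obtain ⟨rfl, rfl⟩ := ihp hp
      obtain ⟨rfl, rfl⟩ := ihq hq
      exact ⟨rfl, rfl⟩
  | iteTrue hb _ ih =>
    intro s₂ t₂ h
    cases h with
    | iteTrue _ hp => obtain ⟨rfl, rfl⟩ := ih hp; exact ⟨rfl, rfl⟩
    | iteFalse hb' _ => exact absurd hb hb'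
  | iteFalse hb _ ih =>
    intro s₂ t₂ h
    cases h with
    | iteTrue hb' _ => exact absurd hb' hb
    | iteFalse _ hq => obtain ⟨rfl, rfl⟩ := ih hq; exact ⟨rfl, rfl⟩
  | loopStop hb =>
    intro s₂ t₂ h
    cases h with
    | loopStop _ => exact ⟨rfl, rfl⟩
    | loopStep hb' _ _ => exact absurd hb' hb
  | loopStep hb _ _ ihp ihl =>
    intro s₂ t₂ h
    cases h with
    | loopStop hb' => exact absurd hb hb'
    | loopStep _ hp hl =>
      obtain ⟨rfl, rfl⟩ := ihp hp
      obtain ⟨rfl, rfl⟩ := ihl hl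
      exact ⟨rfl, rfl⟩
  | _ =>
    intro s₂ t₂ h
    cases h
    exact ⟨rfl, rfl⟩

end RAM

/-! ## The input of the machine -/

namespace MinSumVC

/-- `l` lists every edge of `G` exactly once, in any order and with the ends in any order. -/
def IsEdgeList {n : ℕ} (G : SimpleGraph (Fin n)) (l : List (Fin n × Fin n)) : Prop :=
  (l.map fun p => s(p.1, p.2)).Nodup ∧
    ∀ e : Sym2 (Fin n), e ∈ l.map (fun p => s(p.1, p.2)) ↔ e ∈ G.edgeSet

/-- The initial state: `n`, the number of edges, `k` and `w` are in the registers `0, 1, 2, 3`,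
the ends of the `i`-th edge of the list are in the memory cells `2 i` and `2 i + 1`, and everything
else is `0`. -/
def inputState (n : ℕ) (l : List (Fin n × Fin n)) (k w : ℕ) : RAM.State where
  reg x := [n, l.length, k, w].getD x 0
  mem i := (l.flatMap fun p => [(p.1 : ℕ), (p.2 : ℕ)]).getD i 0

end MinSumVC

set_option linter.unusedSimpArgs false

/-! ## Deleting vertices from an edge set -/

namespace MinSumVC

section EdgeSets

variable {V : Type*} [DecidableEq V]

/-! Counting, for each position, the edges not yet covered before it turns the sum of edge costs
into a sum of remaining edge numbers. Solutions thus correspond to lists of at most `k` vertices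
that meet all edges, with cost `listCost` (`YesInstance.exists_list`, `yesInstance_of_list`).

The branching is controlled by an exchange argument (`exists_large_head`): some optimal list starts
with a vertex of at least average degree. If the head `v` has smaller degree, then by induction the
list for the graph without `v` may start with a vertex `x` of average degree there, this degree
exceeds that of `v`, and swapping `v` and `x` does not raise the cost. So with `r` vertices left to
choose, only vertices of degree at least `|E| / r` need to be tried. The degrees sum to at most `2
|E|`, hence there are at most `2 r` of them (`card_candidates_le`), and the search tree has at most
`2 ^ k * k!` nodes at depth `k`.

To find the candidates without scanning all vertices, put `T = k² + k` and keep only vertices that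
have degree above `T` or a neighbour of degree at most `T` (`IsKernel`). If a cover by `k` vertices
exists, any other vertex has all its neighbours in the cover, so its degree is at most `k`. As long
as it keeps a neighbour, that neighbour still has more than `k²` edges, so the vertex is below the
average (`IsKernel.mem_of_candidate`). In a yes-instance the kernel has at most `k + k T` vertices
(`IsKernel.length_le`); a larger kernel is answered by no. The kernel is found in time linear in the
number of edges, because the memory behind the input is zero and the adjacency matrix needs no
initialization.

The machine runs the search as a single loop with an explicit stack. At every node it tests `O(k³)`
kernel vertices, and computes each residual degree from the stack in `O(k)` steps, which gives the
factor `k⁴`. `visits_node` proves correctness and time together by induction on the remaining depth,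
and `nodeTime_add_le` solves the recurrence for the time. -/

/-- The edges that are left after the deletion of a vertex. -/
def del (E : Finset (Sym2 V)) (v : V) : Finset (Sym2 V) := E.filter fun e => v ∉ e

/-- The edges that are left after the deletion of the vertices of a list. -/
def delList (E : Finset (Sym2 V)) (L : List V) : Finset (Sym2 V) := L.foldl del E

/-- The sum of the numbers of edges that are left just before each of the deletions. -/
def listCost : Finset (Sym2 V) → List V → ℕ
  | _, [] => 0
  | E, v :: L => E.card + listCost (del E v) L

/-- The position of the first vertex of `L` on `e`, and the length of `L` if there is none. -/
def firstPos : List V → Sym2 V → ℕ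
  | [], _ => 0
  | v :: L, e => 1 + if v ∈ e then 0 else firstPos L e

@[simp] theorem mem_del {E : Finset (Sym2 V)} {v : V} {e : Sym2 V} :
    e ∈ del E v ↔ e ∈ E ∧ v ∉ e := by
  simp [del]

theorem del_subset (E : Finset (Sym2 V)) (v : V) : del E v ⊆ E := Finset.filter_subset _ _

@[simp] theorem delList_nil (E : Finset (Sym2 V)) : delList E [] = E := rfl

@[simp] theorem delList_cons (E : Finset (Sym2 V)) (v : V) (L : List V) :
    delList E (v :: L) = delList (del E v) L := rfl

theorem delList_append_singleton (E : Finset (Sym2 V)) (L : List V) (v : V) :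
    delList E (L ++ [v]) = del (delList E L) v := by
  simp [delList]

theorem mem_delList {L : List V} : ∀ {E : Finset (Sym2 V)} {e : Sym2 V},
    e ∈ delList E L ↔ e ∈ E ∧ ∀ v ∈ L, v ∉ e := by
  induction L with
  | nil => simp
  | cons v L ih => intro E e; simp [ih, and_assoc]

theorem delList_eq_empty {L : List V} {E : Finset (Sym2 V)} :
    delList E L = ∅ ↔ ∀ e ∈ E, ∃ v ∈ L, v ∈ e := by
  simp only [Finset.eq_empty_iff_forall_notMem, mem_delList]
  push Not
  rfl

theorem del_comm (E : Finset (Sym2 V)) (u v : V) : del (del E u) v = del (del E v) u := by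
  ext e; simp [and_right_comm]

theorem listCost_eq_sum (L : List V) : ∀ E : Finset (Sym2 V),
    listCost E L = ∑ e ∈ E, firstPos L e := by
  induction L with
  | nil => simp [listCost, firstPos]
  | cons v L ih =>
    intro E
    simp only [listCost, firstPos, ih, Finset.sum_add_distrib, Finset.sum_const, smul_eq_mul,
      mul_one, del, Finset.sum_filter, ite_not]

theorem firstPos_le {L : List V} {e : Sym2 V} : ∀ {i : ℕ} (h : i < L.length), L[i] ∈ e →
    firstPos L e ≤ i + 1 := by
  induction L with
  | nil => intro i h; simp at h
  | cons v L ih =>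
    intro i h hi
    rw [firstPos]
    split_ifs with hv
    · omega
    · cases i with
      | zero => exact absurd hi hv
      | succ i =>
        have := ih (i := i) (by simpa using h) (by simpa using hi)
        omega

theorem exists_firstPos_eq {L : List V} {e : Sym2 V} (h : ∃ v ∈ L, v ∈ e) :
    ∃ (i : ℕ) (h : i < L.length), L[i] ∈ e ∧ firstPos L e = i + 1 := by
  induction L with
  | nil => simp at h
  | cons v L ih =>
    by_cases hv : v ∈ e
    · exact ⟨0, by simp, by simpa, by simp [firstPos, hv]⟩
    · obtain ⟨i, hi, he, hp⟩ := ih (by simpa [hv] using h)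
      exact ⟨i + 1, by simpa, by simpa, by simp [firstPos, hv, hp]; omega⟩

/-! ### Degrees in an edge set and the exchange argument. -/

variable [Fintype V]

/-- The number of edges at a vertex. -/
def edgeDegree (E : Finset (Sym2 V)) (x : V) : ℕ := (Finset.univ.filter fun y => s(x, y) ∈ E).card

theorem edgeDegree_eq_card_filter (E : Finset (Sym2 V)) (x : V) :
    edgeDegree E x = (E.filter fun e => x ∈ e).card := by
  rw [edgeDegree, ← Finset.card_image_of_injective (f := fun y => s(x, y)) _
    (fun y z h => Sym2.congr_right.1 h)]
  congr 1
  ext e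
  simp only [Finset.mem_image, Finset.mem_filter, Finset.mem_univ, true_and]
  constructor
  · rintro ⟨y, hy, rfl⟩; exact ⟨hy, by simp⟩
  · rintro ⟨he, y, rfl⟩; exact ⟨y, he, rfl⟩

theorem card_del_add_edgeDegree (E : Finset (Sym2 V)) (x : V) :
    (del E x).card + edgeDegree E x = E.card := by
  rw [edgeDegree_eq_card_filter, del, add_comm, Finset.card_filter_add_card_filter_not]

theorem edgeDegree_le_card (E : Finset (Sym2 V)) (x : V) : edgeDegree E x ≤ E.card := by
  have := card_del_add_edgeDegree E x; omega

theorem edgeDegree_mono {E F : Finset (Sym2 V)} (h : E ⊆ F) (x : V) :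
    edgeDegree E x ≤ edgeDegree F x :=
  Finset.card_le_card fun y hy => by simp at hy ⊢; exact h hy

theorem edgeDegree_pos {E : Finset (Sym2 V)} {x : V} : 0 < edgeDegree E x ↔ ∃ y, s(x, y) ∈ E := by
  simp [edgeDegree, Finset.card_pos, Finset.Nonempty]

@[simp] theorem edgeDegree_empty (x : V) : edgeDegree ∅ x = 0 := by simp [edgeDegree]

theorem edgeDegree_del_self (E : Finset (Sym2 V)) (x : V) : edgeDegree (del E x) x = 0 := by
  simp [edgeDegree]

theorem edgeDegree_del_of_ne (E : Finset (Sym2 V)) {x y : V} (h : y ≠ x) :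
    edgeDegree (del E y) x = edgeDegree E x - if s(x, y) ∈ E then 1 else 0 := by
  have : (Finset.univ.filter fun z => s(x, z) ∈ del E y) =
      (Finset.univ.filter fun z => s(x, z) ∈ E).erase y := by
    ext z; simp [h]; tauto
  rw [edgeDegree, this, edgeDegree]
  split_ifs with hy
  · rw [Finset.card_erase_of_mem (by simpa)]
  · rw [Finset.erase_eq_of_notMem (by simpa)]; rfl

theorem edgeDegree_insert {E : Finset (Sym2 V)} {u v : V} (huv : u ≠ v) (h : s(u, v) ∉ E) (x : V) :
    edgeDegree (insert s(u, v) E) x =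
      edgeDegree E x + ((if x = u then 1 else 0) + if x = v then 1 else 0) := by
  simp only [edgeDegree_eq_card_filter, Finset.filter_insert, Sym2.mem_iff]
  by_cases hu : x = u
  · subst hu
    simp [huv, h]
  · by_cases hv : x = v
    · subst hv
      simp [hu, h]
    · simp [hu, hv]

theorem sum_edgeDegree_le (E : Finset (Sym2 V)) : ∑ x, edgeDegree E x ≤ 2 * E.card := by
  simp only [edgeDegree_eq_card_filter, Finset.card_filter]
  rw [Finset.sum_comm, mul_comm, ← smul_eq_mul]
  refine Finset.sum_le_card_nsmul _ _ _ fun e _ => ?_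
  rw [← Finset.card_filter]
  induction e with
  | h u v =>
    refine (Finset.card_le_card (t := {u, v}) fun x hx => ?_).trans Finset.card_le_two
    simpa using hx

/-- Few vertices have at least the average degree of a cover with `r` vertices. -/
theorem card_candidates_le {E : Finset (Sym2 V)} (hE : E ≠ ∅) (r : ℕ) (S : Finset V)
    (hS : ∀ x ∈ S, E.card ≤ r * edgeDegree E x) : S.card ≤ 2 * r := by
  have h1 : S.card * E.card ≤ ∑ x ∈ S, r * edgeDegree E x := by
    rw [← smul_eq_mul]; exact Finset.card_nsmul_le_sum _ _ _ hS
  have h2 : ∑ x ∈ S, r * edgeDegree E x ≤ r * (2 * E.card) := by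
    rw [← Finset.mul_sum]
    exact Nat.mul_le_mul_left _ ((Finset.sum_le_univ_sum_of_nonneg fun _ => Nat.zero_le _).trans
      (sum_edgeDegree_le E))
  have h3 : 0 < E.card := Finset.card_pos.2 (Finset.nonempty_iff_ne_empty.2 hE)
  refine Nat.le_of_mul_le_mul_right (h1.trans (h2.trans_eq ?_)) h3
  ring

/-- Every cover can be rearranged, without an increase of the cost, such that its first vertex has
at least the average degree. -/
theorem exists_large_head (L : List V) : ∀ E : Finset (Sym2 V), E ≠ ∅ → delList E L = ∅ →
    ∃ (x : V) (L' : List V), (x :: L').length = L.length ∧ delList E (x :: L') = ∅ ∧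
      listCost E (x :: L') ≤ listCost E L ∧ E.card ≤ L.length * edgeDegree E x := by
  induction L with
  | nil => intro E hE h; exact absurd h hE
  | cons v L ih =>
    intro E hE h
    by_cases hv : E.card ≤ (v :: L).length * edgeDegree E v
    · exact ⟨v, L, rfl, h, le_rfl, hv⟩
    have hc := card_del_add_edgeDegree E v
    have hne : del E v ≠ ∅ := by
      intro h0
      rw [h0] at hc
      apply hv
      simp only [Finset.card_empty, zero_add] at hc
      rw [hc, List.length_cons]
      exact Nat.le_mul_of_pos_left _ (Nat.succ_pos _)
    obtain ⟨x, L', hl, hd, hle, hx⟩ := ih (del E v) hne (by simpa using h)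
    have hmono := edgeDegree_mono (del_subset E v) x
    have hcx := card_del_add_edgeDegree E x
    -- Here `|E| > (|L| + 1) deg v`, so `|E - v| > |L| deg v`, whereas `x` satisfies `|E - v| ≤ |L|
    -- deg x` in `E - v`. Hence `x` beats `v` and swapping them leaves fewer edges after the first
    -- deletion.
    have hlt : edgeDegree E v < edgeDegree (del E v) x := by
      by_contra! hge
      have := Nat.mul_le_mul_left L.length hge
      simp only [List.length_cons, Nat.add_mul, one_mul] at hv
      omega
    refine ⟨x, v :: L', by simpa using hl, ?_, ?_, ?_⟩
    · rw [delList_cons, delList_cons, del_comm]; simpa using hd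
    · simp only [listCost] at hle ⊢
      rw [del_comm E x v]
      omega
    · have := Nat.mul_le_mul_left L.length hmono
      simp only [List.length_cons, Nat.add_mul, one_mul]
      omega

/-! ### The abstract search and its correctness relative to a candidate list. -/

/-- The search that tries the vertices of `X` whose degree is at least the average degree of a
cover with `r` vertices succeeds, with costs `c` so far. -/
def Succeeds (X : List V) (w : ℕ) : ℕ → Finset (Sym2 V) → ℕ → Prop
  | 0, E, c => E = ∅ ∧ c ≤ w
  | r + 1, E, c => (E = ∅ ∧ c ≤ w) ∨ E ≠ ∅ ∧ ∃ x ∈ X, E.card ≤ (r + 1) * edgeDegree E x ∧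
      Succeeds X w r (del E x) (c + E.card)

/-- A vertex accepted by the degree test has positive degree, and degree zero once deleted. It is
therefore never chosen twice, which gives the duplicate-free list that a numbering needs. -/
theorem Succeeds.exists_list {X : List V} {w r : ℕ} : ∀ {E : Finset (Sym2 V)} {c : ℕ},
    Succeeds X w r E c → ∃ L : List V, L.Nodup ∧ (∀ x ∈ L, 0 < edgeDegree E x) ∧ L.length ≤ r ∧
      delList E L = ∅ ∧ c + listCost E L ≤ w := by
  induction r with
  | zero => rintro E c ⟨rfl, hc⟩; exact ⟨[], by simp, by simp, by simp, by simp, by simpa [listCost]⟩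
  | succ r ih =>
    rintro E c (⟨rfl, hc⟩ | ⟨hE, x, -, hx, hs⟩)
    · exact ⟨[], by simp, by simp, by simp, by simp, by simpa [listCost]⟩
    · obtain ⟨L, hn, hp, hl, hd, hc⟩ := ih hs
      have hpos : 0 < E.card := Finset.card_pos.2 (Finset.nonempty_iff_ne_empty.2 hE)
      refine ⟨x :: L, ?_, ?_, by simpa, by simpa, by simpa [listCost, add_assoc] using hc⟩
      · refine List.nodup_cons.2 ⟨fun hm => ?_, hn⟩
        exact (hp x hm).ne' (edgeDegree_del_self E x)
      · intro y hy
        rcases List.mem_cons.1 hy with rfl | hy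
        · exact Nat.pos_of_ne_zero fun h => by rw [h] at hx; omega
        · exact (hp y hy).trans_le (edgeDegree_mono (del_subset E x) y)

/-- The exchange argument is applied again at every level, so the search need not follow the given
list. `Z` records the vertices deleted so far; `hX` asks only that every vertex passing the degree
test be in `X`. -/
theorem succeeds_of_list {X : List V} {w k : ℕ} {E₀ : Finset (Sym2 V)}
    (hX : ∀ (Z : List V) (r : ℕ) (x : V), Z.length + r = k → delList E₀ Z ≠ ∅ →
      (delList E₀ Z).card ≤ r * edgeDegree (delList E₀ Z) x → x ∈ X) (r : ℕ) :
    ∀ (Z L : List V) (c : ℕ), Z.length + r = k → L.length ≤ r → delList (delList E₀ Z) L = ∅ →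
      c + listCost (delList E₀ Z) L ≤ w → Succeeds X w r (delList E₀ Z) c := by
  induction r with
  | zero =>
    intro Z L c _ hl hd hc
    obtain rfl := List.length_eq_zero_iff.1 (Nat.le_zero.1 hl)
    exact ⟨by simpa using hd, by omega⟩
  | succ r ih =>
    intro Z L c hZ hl hd hc
    by_cases hE : delList E₀ Z = ∅
    · exact Or.inl ⟨hE, by omega⟩
    · obtain ⟨x, L', hl', hd', hle, hx⟩ := exists_large_head L _ hE hd
      have hx' : (delList E₀ Z).card ≤ (r + 1) * edgeDegree (delList E₀ Z) x :=
        hx.trans (Nat.mul_le_mul_right _ hl)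
      refine Or.inr ⟨hE, x, hX Z (r + 1) x hZ hE hx', hx', ?_⟩
      rw [← delList_append_singleton]
      refine ih _ L' _ (by simp; omega) (by simp at hl'; omega) ?_ ?_
      · rw [delList_append_singleton]; simpa using hd'
      · rw [delList_append_singleton]
        simp only [listCost] at hle
        omega

/-! ### The vertices that the search has to consider -/

/-- Deleting a vertex other than `u` removes at most one neighbour of `u`. -/
theorem edgeDegree_le_delList_add (L : List V) : ∀ (E : Finset (Sym2 V)) {u : V}, u ∉ L →
    edgeDegree E u ≤ edgeDegree (delList E L) u + L.length := by
  induction L with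
  | nil => simp
  | cons v L ih =>
    intro E u hu
    simp only [List.mem_cons, not_or] at hu
    have h1 := ih (del E v) hu.2
    have h2 := edgeDegree_del_of_ne E (Ne.symm hu.1)
    have h3 : (if s(u, v) ∈ E then 1 else 0) ≤ 1 := by split_ifs <;> simp
    simp only [delList_cons, List.length_cons]
    omega

theorem mem_of_length_lt_edgeDegree {E : Finset (Sym2 V)} {L : List V} (h : delList E L = ∅) {x : V}
    (hx : L.length < edgeDegree E x) : x ∈ L := by
  by_contra hn
  have := edgeDegree_le_delList_add L E hn
  simp [h] at this
  omega

/-- A set that contains all vertices of large degree and all vertices with a neighbour of small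
degree. -/
def IsKernel (E : Finset (Sym2 V)) (T : ℕ) (X : List V) : Prop :=
  ∀ x, x ∈ X ↔ ∃ u, s(x, u) ∈ E ∧ (T < edgeDegree E x ∨ edgeDegree E u ≤ T)

/-- A kernel vertex `x` outside the cover has degree at most `|L| ≤ T`, so it is in the kernel
because of a neighbour of degree at most `T`. That neighbour must be in the cover, so `x` is one of
the at most `|L| * T` neighbours of such cover vertices. -/
theorem IsKernel.length_le {E : Finset (Sym2 V)} {T : ℕ} {X L : List V} (hX : IsKernel E T X)
    (hn : X.Nodup) (hL : delList E L = ∅) (hT : L.length ≤ T) :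
    X.length ≤ L.length + L.length * T := by
  have hsub : X.toFinset ⊆ L.toFinset ∪ (L.toFinset.filter fun u => edgeDegree E u ≤ T).biUnion
      fun u => Finset.univ.filter fun y => s(u, y) ∈ E := by
    intro x hx
    rw [List.mem_toFinset, hX x] at hx
    obtain ⟨u, hu, h⟩ := hx
    simp only [Finset.mem_union, List.mem_toFinset, Finset.mem_biUnion, Finset.mem_filter,
      Finset.mem_univ, true_and]
    by_cases hxL : x ∈ L
    · exact Or.inl hxL
    · have hxT : ¬ T < edgeDegree E x := fun h' =>
        hxL (mem_of_length_lt_edgeDegree hL (hT.trans_lt h'))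
      obtain ⟨v, hv, hve⟩ := delList_eq_empty.1 hL _ hu
      rcases Sym2.mem_iff.1 hve with rfl | rfl
      · exact absurd hv hxL
      · exact Or.inr ⟨v, ⟨hv, h.resolve_left hxT⟩, by rwa [Sym2.eq_swap]⟩
  rw [← List.toFinset_card_of_nodup hn]
  have hc := List.toFinset_card_le L
  refine (Finset.card_le_card hsub).trans ((Finset.card_union_le _ _).trans (add_le_add hc ?_))
  refine (Finset.card_biUnion_le_card_mul _ _ T fun u hu => ?_).trans
    (Nat.mul_le_mul_right _ ((Finset.card_filter_le _ _).trans hc))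
  exact (Finset.mem_filter.1 hu).2

/-- The threshold `k² + k` leaves room for two losses: `k` for the deleted vertices `Z`, and `k²`
for the largest possible value of `r` times the degree of a vertex outside the kernel. -/
theorem IsKernel.mem_of_candidate {E : Finset (Sym2 V)} {k : ℕ} {X L : List V}
    (hX : IsKernel E (k * k + k) X) (hL : delList E L = ∅) (hk : L.length ≤ k) (Z : List V)
    (r : ℕ) (x : V) (hZ : Z.length + r = k) (hne : delList E Z ≠ ∅)
    (hx : (delList E Z).card ≤ r * edgeDegree (delList E Z) x) : x ∈ X := by
  by_contra hxX
  rw [hX x] at hxX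
  push Not at hxX
  have hpos : 0 < edgeDegree (delList E Z) x := by
    refine Nat.pos_of_ne_zero fun h => hne ?_
    rw [h] at hx
    exact Finset.card_eq_zero.1 (by omega)
  obtain ⟨u, hu⟩ := edgeDegree_pos.1 hpos
  have huE := (mem_delList.1 hu).1
  have huZ : u ∉ Z := fun h => (mem_delList.1 hu).2 u h (by simp)
  have h1 := edgeDegree_le_delList_add Z E huZ
  have h2 := edgeDegree_le_card (delList E Z) u
  have h3 := (hxX u huE).2
  -- Every neighbour of `x` has degree above `k² + k ≥ |L|`, so it is in the cover `L`.
  have h4 : edgeDegree (delList E Z) x ≤ k := by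
    refine le_trans ?_ ((List.toFinset_card_le L).trans hk)
    refine Finset.card_le_card fun y hy => ?_
    have hyE := (mem_delList.1 (Finset.mem_filter.1 hy).2).1
    refine List.mem_toFinset.2 (mem_of_length_lt_edgeDegree hL ?_)
    have := (hxX y hyE).2
    have : k ≤ k * k + k := Nat.le_add_left _ _
    omega
  -- The neighbour `u` alone keeps more than `k²` edges, which contradicts `hx`.
  have h5 : r * edgeDegree (delList E Z) x ≤ k * k := Nat.mul_le_mul (by omega) h4
  omega

end EdgeSets

/-! ### Solutions and lists of vertices -/

section Solutions

variable {V : Type*} [Fintype V]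

theorem edgeCost_le_position (σ : Solution V) {e : Sym2 V} {v : V} (hv : v ∈ e) :
    edgeCost σ e ≤ position σ v := by
  induction e with
  | h a b =>
    rcases Sym2.mem_iff.1 hv with rfl | rfl
    · exact min_le_left _ _
    · exact min_le_right _ _

theorem exists_edgeCost_eq_position (σ : Solution V) (e : Sym2 V) :
    ∃ v ∈ e, edgeCost σ e = position σ v := by
  induction e with
  | h a b =>
    rcases min_choice (position σ a) (position σ b) with h | h
    · exact ⟨a, by simp, h⟩
    · exact ⟨b, by simp, h⟩

variable [DecidableEq V] (G : SimpleGraph V) [Fintype G.edgeSet]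

/-- The first `k` vertices of the numbering form the list: every edge has cost at most `k`, so its
earlier end is among them. -/
theorem YesInstance.exists_list {k w : ℕ} (h : YesInstance G k w) :
    ∃ L : List V, L.length ≤ k ∧ delList G.edgeFinset L = ∅ ∧ listCost G.edgeFinset L ≤ w := by
  obtain ⟨σ, hk, hw⟩ := h
  have key : ∀ e ∈ G.edgeFinset, ∃ (i : ℕ) (hi : i < ((List.ofFn σ.symm).take k).length),
      ((List.ofFn σ.symm).take k)[i] ∈ e ∧ i + 1 = edgeCost σ e := by
    intro e he
    obtain ⟨v, hv, hp⟩ := exists_edgeCost_eq_position σ e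
    have h1 : edgeCost σ e ≤ k := (Finset.le_sup (f := edgeCost σ) he).trans hk
    rw [hp, position] at h1
    refine ⟨σ v, ?_, ?_, hp.symm⟩
    · simp only [List.length_take, List.length_ofFn]
      exact lt_min (by omega) (σ v).2
    · simpa using hv
  refine ⟨(List.ofFn σ.symm).take k, List.length_take_le _ _, ?_, ?_⟩
  · rw [delList_eq_empty]
    intro e he
    obtain ⟨i, hi, hie, -⟩ := key e he
    exact ⟨_, List.getElem_mem hi, hie⟩
  · rw [listCost_eq_sum]
    refine le_trans (Finset.sum_le_sum fun e he => ?_) hw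
    obtain ⟨i, hi, hie, hc⟩ := key e he
    exact (firstPos_le hi hie).trans_eq hc

/-- The vertices outside the list are numbered after it in any order. An edge is charged at most the
position of its first list vertex, so the tail does not matter. -/
theorem yesInstance_of_list {k w : ℕ} {L : List V} (hn : L.Nodup) (hk : L.length ≤ k)
    (hd : delList G.edgeFinset L = ∅) (hw : listCost G.edgeFinset L ≤ w) : YesInstance G k w := by
  set M : List V := L ++ Finset.univ.toList.filter (· ∉ L) with hM
  have hMn : M.Nodup := by
    refine List.Nodup.append hn ((Finset.nodup_toList _).filter _) ?_
    intro a ha hb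
    simp at hb
    exact hb ha
  have hMm : ∀ v, v ∈ M := fun v => by
    by_cases hv : v ∈ L <;> simp [hM, hv]
  have hMl : M.length = Fintype.card V := by
    rw [← List.toFinset_card_of_nodup hMn, ← Finset.card_univ]
    congr 1
    ext v; simp [hMm v]
  let σ : Solution V := (hMn.getEquivOfForallMemList M hMm).symm.trans (finCongr hMl)
  have hpos : ∀ (i : ℕ) (hi : i < L.length), position σ L[i] = i + 1 := by
    intro i hi
    have hi' : i < M.length := by simp [hM]; omega
    have : L[i] = hMn.getEquivOfForallMemList M hMm ⟨i, hi'⟩ := by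
      simp [hM, List.getElem_append_left hi]
    rw [this]
    simp [position, σ, hMn.idxOf_getElem]
  have key : ∀ e ∈ G.edgeFinset, edgeCost σ e ≤ firstPos L e ∧ edgeCost σ e ≤ k := by
    intro e he
    obtain ⟨i, hi, hie, hp⟩ := exists_firstPos_eq (delList_eq_empty.1 hd e he)
    have := edgeCost_le_position σ hie
    rw [hpos i hi] at this
    exact ⟨by omega, by omega⟩
  refine ⟨σ, Finset.sup_le fun e he => (key e he).2, ?_⟩
  rw [listCost_eq_sum] at hw
  exact (Finset.sum_le_sum fun e he => (key e he).1).trans hw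

/-- The search is correct. -/
theorem IsKernel.succeeds_iff {k w : ℕ} {X : List V} (hX : IsKernel G.edgeFinset (k * k + k) X) :
    Succeeds X w k G.edgeFinset 0 ↔ YesInstance G k w := by
  constructor
  · intro h
    obtain ⟨L, hn, -, hk, hd, hc⟩ := h.exists_list
    exact yesInstance_of_list G hn hk hd (by omega)
  · intro h
    obtain ⟨L, hk, hd, hc⟩ := h.exists_list G
    exact succeeds_of_list (E₀ := G.edgeFinset) (fun Z r x => hX.mem_of_candidate hd hk Z r x) k []
      L 0 (by simp) hk (by simpa) (by simpa)

theorem YesInstance.kernel_length_le {k w : ℕ} {X : List V} (h : YesInstance G k w)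
    (hX : IsKernel G.edgeFinset (k * k + k) X) (hn : X.Nodup) :
    X.length ≤ k + k * (k * k + k) := by
  obtain ⟨L, hk, hd, -⟩ := h.exists_list G
  refine (hX.length_le hn hd (hk.trans (Nat.le_add_left _ _))).trans ?_
  exact add_le_add hk (Nat.mul_le_mul_right _ hk)

end Solutions

end MinSumVC

/-! ## Symbolic execution -/

namespace RAM

@[simp] theorem State.setReg_reg (s : State) (x a y : ℕ) :
    (s.setReg x a).reg y = if y = x then a else s.reg y := by
  simp [State.setReg, Function.update_apply]

@[simp] theorem State.setReg_mem (s : State) (x a : ℕ) : (s.setReg x a).mem = s.mem := rfl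

@[simp] theorem State.setMem_reg (s : State) (i a : ℕ) : (s.setMem i a).reg = s.reg := rfl

@[simp] theorem State.setMem_mem (s : State) (i a j : ℕ) :
    (s.setMem i a).mem j = if j = i then a else s.mem j := by
  simp [State.setMem, Function.update_apply]

/-- Started in `s`, the program halts, in a state and after a number of steps that satisfy `Q`. -/
def Runs (B : ℕ) (p : Prog) (s : State) (Q : State → ℕ → Prop) : Prop :=
  ∃ s' t, Exec B p s s' t ∧ Q s' t

variable {B : ℕ}

theorem Runs.mono {p : Prog} {s : State} {Q Q' : State → ℕ → Prop} (h : Runs B p s Q)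
    (hQ : ∀ s' t, Q s' t → Q' s' t) : Runs B p s Q' :=
  let ⟨s', t, he, hq⟩ := h
  ⟨s', t, he, hQ _ _ hq⟩

theorem runs_skip {s : State} {Q : State → ℕ → Prop} : Runs B .skip s Q ↔ Q s 1 :=
  ⟨fun ⟨_, _, h, hq⟩ => by cases h; exact hq, fun h => ⟨_, _, .skip s, h⟩⟩

theorem runs_const {s : State} {x c : ℕ} {Q : State → ℕ → Prop} :
    Runs B (.const x c) s Q ↔ c < B ∧ Q (s.setReg x c) 1 :=
  ⟨fun ⟨_, _, h, hq⟩ => by cases h; exact ⟨‹_›, hq⟩, fun h => ⟨_, _, .const s x c h.1, h.2⟩⟩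

theorem runs_copy {s : State} {x y : ℕ} {Q : State → ℕ → Prop} :
    Runs B (.copy x y) s Q ↔ s.reg y < B ∧ Q (s.setReg x (s.reg y)) 1 :=
  ⟨fun ⟨_, _, h, hq⟩ => by cases h; exact ⟨‹_›, hq⟩, fun h => ⟨_, _, .copy s x y h.1, h.2⟩⟩

theorem runs_arith {s : State} {o : Op} {x y z : ℕ} {Q : State → ℕ → Prop} :
    Runs B (.arith o x y z) s Q ↔
      o.eval (s.reg y) (s.reg z) < B ∧ Q (s.setReg x (o.eval (s.reg y) (s.reg z))) 1 :=
  ⟨fun ⟨_, _, h, hq⟩ => by cases h; exact ⟨‹_›, hq⟩, fun h => ⟨_, _, .arith s o x y z h.1, h.2⟩⟩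

theorem runs_load {s : State} {x y : ℕ} {Q : State → ℕ → Prop} :
    Runs B (.load x y) s Q ↔
      s.mem (s.reg y) < B ∧ Q (s.setReg x (s.mem (s.reg y))) 1 :=
  ⟨fun ⟨_, _, h, hq⟩ => by cases h; exact ⟨‹_›, hq⟩, fun h => ⟨_, _, .load s x y h.1, h.2⟩⟩

theorem runs_store {s : State} {x y : ℕ} {Q : State → ℕ → Prop} :
    Runs B (.store x y) s Q ↔
      (s.reg x < B ∧ s.reg y < B) ∧ Q (s.setMem (s.reg x) (s.reg y)) 1 :=
  ⟨fun ⟨_, _, h, hq⟩ => by cases h; exact ⟨⟨‹_›, ‹_›⟩, hq⟩,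
    fun h => ⟨_, _, .store s x y h.1.1 h.1.2, h.2⟩⟩

/-- The equivalences for the instructions serve as weakest preconditions: rewriting with them
executes straight-line code and leaves the word bounds and the postcondition as goals. -/
theorem runs_seq {p q : Prog} {s : State} {Q : State → ℕ → Prop} :
    Runs B (.seq p q) s Q ↔
      Runs B p s fun s' t => Runs B q s' fun s'' t' => Q s'' (t + t') :=
  ⟨fun ⟨_, _, h, hq⟩ => by cases h with | seq hp hq' => exact ⟨_, _, hp, _, _, hq', hq⟩,
    fun ⟨_, _, hp, _, _, hq', hq⟩ => ⟨_, _, .seq hp hq', hq⟩⟩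

theorem runs_ite {b : Test} {p q : Prog} {s : State} {Q : State → ℕ → Prop} :
    Runs B (.ite b p q) s Q ↔
      (b.Holds s → Runs B p s fun s' t => Q s' (t + 1)) ∧
        (¬ b.Holds s → Runs B q s fun s' t => Q s' (t + 1)) := by
  constructor
  · rintro ⟨_, _, h, hq⟩
    cases h with
    | iteTrue hb hp => exact ⟨fun _ => ⟨_, _, hp, hq⟩, fun h => absurd hb h⟩
    | iteFalse hb hp => exact ⟨fun h => absurd h hb, fun _ => ⟨_, _, hp, hq⟩⟩
  · rintro ⟨h1, h2⟩
    by_cases hb : b.Holds s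
    · obtain ⟨_, _, hp, hq⟩ := h1 hb
      exact ⟨_, _, .iteTrue hb hp, hq⟩
    · obtain ⟨_, _, hp, hq⟩ := h2 hb
      exact ⟨_, _, .iteFalse hb hp, hq⟩

theorem Runs.loopStop {b : Test} {p : Prog} {s : State} {Q : State → ℕ → Prop}
    (hb : ¬ b.Holds s) (h : Q s 1) : Runs B (.loop b p) s Q :=
  ⟨_, _, .loopStop hb, h⟩

theorem Runs.loopStep {b : Test} {p : Prog} {s : State} {Q : State → ℕ → Prop} (hb : b.Holds s)
    (h : Runs B p s fun s' t => Runs B (.loop b p) s' fun s'' t' => Q s'' (t + t' + 1)) :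
    Runs B (.loop b p) s Q :=
  let ⟨_, _, hp, _, _, hl, hq⟩ := h
  ⟨_, _, .loopStep hb hp hl, hq⟩

end RAM


/-! ## The program -/

namespace MinSumVC

open RAM

-- Registers and the layout of the memory.

notation "rN" => (0 : ℕ)
notation "rM" => (1 : ℕ)
notation "rK" => (2 : ℕ)
notation "rW" => (3 : ℕ)
notation "rZero" => (4 : ℕ)
notation "rOne" => (5 : ℕ)
notation "rEight" => (6 : ℕ)
notation "rBase" => (7 : ℕ)
notation "rCount" => (8 : ℕ)
notation "rDepth" => (9 : ℕ)
notation "rEdges" => (10 : ℕ)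
notation "rCost" => (11 : ℕ)
notation "rIndex" => (12 : ℕ)
notation "rRun" => (13 : ℕ)
notation "rU" => (14 : ℕ)
notation "rDegU" => (15 : ℕ)
notation "rI" => (16 : ℕ)
notation "rV" => (17 : ℕ)
notation "rDegV" => (18 : ℕ)
notation "rAddr" => (19 : ℕ)
notation "rTag" => (20 : ℕ)
notation "rThreshold" => (21 : ℕ)
notation "rTemp" => (22 : ℕ)

/-- Behind the `m` edges of the input, the memory is divided into eight arrays. -/
def cell (m tag i : ℕ) : ℕ := i * 8 + 2 * m + tag

notation "degreeArray" => (0 : ℕ)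
notation "markArray" => (1 : ℕ)
notation "kernelArray" => (2 : ℕ)
notation "adjacencyArray" => (3 : ℕ)
notation "vertexStack" => (4 : ℕ)
notation "indexStack" => (5 : ℕ)
notation "edgesStack" => (6 : ℕ)

/-- Put the address of an array element into the address register. -/
def addressOf (tag i : ℕ) : Prog :=
  .seq (.arith .mul rAddr i rEight) <| .seq (.arith .add rAddr rAddr rBase) <|
    .seq (.const rTag tag) (.arith .add rAddr rAddr rTag)

/-- `x := array[i]` -/
def getCell (x tag i : ℕ) : Prog := .seq (addressOf tag i) (.load x rAddr)

/-- `array[i] := x` -/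
def putCell (tag i x : ℕ) : Prog := .seq (addressOf tag i) (.store rAddr x)

theorem runs_getCell {B : ℕ} (m : ℕ) {s : State} {x tag i : ℕ} {Q : State → ℕ → Prop}
    (h8 : s.reg rEight = 8) (hb : s.reg rBase = 2 * m) :
    Runs B (getCell x tag i) s Q ↔ (cell m tag (s.reg i) < B ∧ s.mem (cell m tag (s.reg i)) < B) ∧
      Q (((s.setReg rTag tag).setReg rAddr (cell m tag (s.reg i))).setReg x
        (s.mem (cell m tag (s.reg i)))) 5 := by
  have hs : ∀ a b, (((s.setReg rAddr a).setReg rAddr b).setReg rTag tag).setReg rAddr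
      (cell m tag (s.reg i)) = (s.setReg rTag tag).setReg rAddr (cell m tag (s.reg i)) := by
    -- The successive writes to the address and tag registers collapse to one write each, so later
    -- states stay small.
    intro a b
    simp only [State.setReg, State.mk.injEq, and_true]
    ext y
    simp only [Function.update_apply]
    split_ifs <;> rfl
  simp only [getCell, addressOf, runs_seq, runs_arith, runs_const, runs_load, Op.eval,
    State.setReg_reg, State.setReg_mem, h8, hb, if_true, reduceIte, Nat.reduceEqDiff]
  simp only [← cell.eq_1, hs]
  simp only [cell]
  constructor
  · rintro ⟨-, -, -, h1, h2, h3⟩; exact ⟨⟨h1, h2⟩, h3⟩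
  -- All intermediate values of the address computation are at most the final address, so its bound
  -- suffices.
  · rintro ⟨⟨h1, h2⟩, h3⟩; exact ⟨by omega, by omega, by omega, h1, h2, h3⟩

theorem runs_putCell {B : ℕ} (m : ℕ) {s : State} {x tag i : ℕ} {Q : State → ℕ → Prop}
    (h8 : s.reg rEight = 8) (hb : s.reg rBase = 2 * m) (hx : x ≠ rAddr) (hx' : x ≠ rTag) :
    Runs B (putCell tag i x) s Q ↔ (cell m tag (s.reg i) < B ∧ s.reg x < B) ∧
      Q (((s.setReg rTag tag).setReg rAddr (cell m tag (s.reg i))).setMem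
        (cell m tag (s.reg i)) (s.reg x)) 5 := by
  have hs : ∀ a b, (((s.setReg rAddr a).setReg rAddr b).setReg rTag tag).setReg rAddr
      (cell m tag (s.reg i)) = (s.setReg rTag tag).setReg rAddr (cell m tag (s.reg i)) := by
    intro a b
    simp only [State.setReg, State.mk.injEq, and_true]
    ext y
    simp only [Function.update_apply]
    split_ifs <;> rfl
  simp only [putCell, addressOf, runs_seq, runs_arith, runs_const, runs_store, Op.eval,
    State.setReg_reg, h8, hb, if_true, reduceIte, Nat.reduceEqDiff, hx, hx']
  simp only [← cell.eq_1, hs]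
  simp only [cell]
  constructor
  · rintro ⟨-, -, -, -, h1, h2⟩; exact ⟨h1, h2⟩
  · rintro ⟨⟨h1, h2⟩, h3⟩; exact ⟨by omega, by omega, by omega, h1, ⟨h1, h2⟩, h3⟩

@[simp] theorem cell_inj {m t t' i j : ℕ} (ht : t < 8) (ht' : t' < 8) :
    cell m t i = cell m t' j ↔ t = t' ∧ i = j := by
  unfold cell; omega

/-- Increment the degree of the vertex in the register `x`. -/
def bumpDegree (x : ℕ) : Prog :=
  .seq (getCell rTemp degreeArray x) <| .seq (.arith .add rTemp rTemp rOne) <|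
    putCell degreeArray x rTemp

/-- Make an entry in the adjacency matrix. -/
def markAdjacent (x y : ℕ) : Prog :=
  .seq (.arith .mul rTemp x rN) <| .seq (.arith .add rTemp rTemp y) <|
    putCell adjacencyArray rTemp rOne

/-- Read the ends of the edge with the number in `rI`. -/
def readEdge : Prog :=
  .seq (.arith .add rTemp rI rI) <| .seq (.load rU rTemp) <|
    .seq (.arith .add rTemp rTemp rOne) (.load rV rTemp)

/-- Compute the degrees and the adjacency matrix. -/
def degreeLoop : Prog :=
  .loop (.lt rI rM) <| .seq readEdge <| .seq (bumpDegree rU) <| .seq (bumpDegree rV) <|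
    .seq (markAdjacent rU rV) <| .seq (markAdjacent rV rU) (.arith .add rI rI rOne)

/-- Append the vertex in the register `x` to the list of kernel vertices unless it is there. -/
def addToKernel (x : ℕ) : Prog :=
  .seq (getCell rTemp markArray x) <|
    .ite (.eq rTemp rZero)
      (.seq (putCell markArray x rOne) <| .seq (putCell kernelArray rCount x)
        (.arith .add rCount rCount rOne))
      .skip

/-- Append the vertex in the register `x` to the list of kernel vertices if its degree in `dx` is
large or the degree in `dy` of its neighbour is small. -/
def considerVertex (x dx dy : ℕ) : Prog :=
  .ite (.lt rThreshold dx) (addToKernel x) (.ite (.lt rThreshold dy) .skip (addToKernel x))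

/-- Compute the list of the kernel vertices. -/
def kernelLoop : Prog :=
  .loop (.lt rI rM) <| .seq readEdge <| .seq (getCell rDegU degreeArray rU) <|
    .seq (getCell rDegV degreeArray rV) <| .seq (considerVertex rU rDegU rDegV) <|
    .seq (considerVertex rV rDegV rDegU) (.arith .add rI rI rOne)

/-- Compute the degree of the vertex in `rU` after the deletion of the vertices on the stack. -/
def residualLoop : Prog :=
  .loop (.lt rZero rI) <| .seq (.arith .sub rI rI rOne) <| .seq (getCell rV vertexStack rI) <|
    .ite (.eq rV rU) (.const rDegU 0) <|
      .seq (.arith .mul rTemp rU rN) <| .seq (.arith .add rTemp rTemp rV) <|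
        .seq (getCell rTemp adjacencyArray rTemp) (.arith .sub rDegU rDegU rTemp)

/-- Halt the search with the given answer. -/
def answer (b : ℕ) : Prog := .seq (.const rN b) (.const rRun 0)

/-- Return from a node of the search tree to the next child of its parent. -/
def popNode : Prog :=
  .ite (.eq rDepth rZero) (answer 0) <|
    .seq (.arith .sub rDepth rDepth rOne) <| .seq (getCell rIndex indexStack rDepth) <|
    .seq (.arith .add rIndex rIndex rOne) <| .seq (getCell rEdges edgesStack rDepth)
      (.arith .sub rCost rCost rEdges)

/-- Go to the child of a node of the search tree for the vertex in `rU`. -/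
def pushNode : Prog :=
  .seq (putCell vertexStack rDepth rU) <| .seq (putCell indexStack rDepth rIndex) <|
    .seq (putCell edgesStack rDepth rEdges) <| .seq (.arith .add rCost rCost rEdges) <|
    .seq (.arith .sub rEdges rEdges rDegU) <| .seq (.arith .add rDepth rDepth rOne)
      (.const rIndex 0)

/-- Try the kernel vertex with the number in `rIndex`. -/
def tryVertex : Prog :=
  .seq (getCell rU kernelArray rIndex) <| .seq (getCell rDegU degreeArray rU) <|
    .seq (.copy rI rDepth) <| .seq residualLoop <| .seq (.arith .sub rTemp rK rDepth) <|
    .seq (.arith .mul rTemp rTemp rDegU) <|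
    .ite (.lt rTemp rEdges) (.arith .add rIndex rIndex rOne) pushNode

/-- One step of the search. -/
def searchStep : Prog :=
  .ite (.eq rEdges rZero) (.ite (.lt rW rCost) popNode (answer 1)) <|
    .ite (.eq rDepth rK) popNode <| .ite (.eq rIndex rCount) popNode tryVertex

/-- The search. -/
def searchLoop : Prog := .loop (.eq rRun rOne) searchStep

/-- Initialize the constants. -/
def setConstants : Prog :=
  .seq (.const rOne 1) <| .seq (.const rEight 8) <| .seq (.arith .add rBase rM rM) <|
    .seq (.arith .mul rThreshold rK rK) (.arith .add rThreshold rThreshold rK)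

/-- Initialize the search and run it, if the kernel is small enough. -/
def searchPhase : Prog :=
  .seq (.arith .mul rTemp rK rThreshold) <| .seq (.arith .add rTemp rTemp rK) <|
    .ite (.lt rTemp rCount) (.const rN 0) <|
      .seq (.copy rEdges rM) <| .seq (.const rRun 1) searchLoop

/-- The algorithm. -/
def program : Prog :=
  .seq setConstants <| .seq degreeLoop <| .seq (.const rI 0) <| .seq kernelLoop searchPhase

end MinSumVC

/-! ## The preprocessing -/

namespace MinSumVC

open RAM

/-- The constants of the program. -/
structure Constants (n m k w : ℕ) (s : State) : Prop where
  vertices : s.reg rN = n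
  edges : s.reg rM = m
  maxCost : s.reg rK = k
  totalCost : s.reg rW = w
  zero : s.reg rZero = 0
  one : s.reg rOne = 1
  eight : s.reg rEight = 8
  base : s.reg rBase = 2 * m
  threshold : s.reg rThreshold = k * k + k

/-! ### Word size. -/

/-- The bound `B` is large enough for the numbers that the program computes. -/
structure Fits (n m k w B : ℕ) : Prop where
  cell : ∀ tag i, tag < 8 → i ≤ (n + m + k + w + 2) ^ 2 → cell m tag i < B
  cube : 3 * (n + m + k + w + 2) ^ 3 < B

theorem fits (n m k w : ℕ) : Fits n m k w ((n + m + k + w + 2) ^ 8) := by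
  have hm : m ≤ n + m + k + w + 2 := by omega
  have h2 : 2 ≤ n + m + k + w + 2 := by omega
  suffices ∀ N, m ≤ N → 2 ≤ N →
      (∀ tag i, tag < 8 → i ≤ N ^ 2 → MinSumVC.cell m tag i < N ^ 8) ∧ 3 * N ^ 3 < N ^ 8 from
    ⟨(this _ hm h2).1, (this _ hm h2).2⟩
  intro N hm h2
  have h3 : 8 ≤ N ^ 3 := by simpa using Nat.pow_le_pow_left h2 3
  have h5 : 32 ≤ N ^ 5 := by simpa using Nat.pow_le_pow_left h2 5
  have h6 : N ^ 3 * 32 ≤ N ^ 3 * N ^ 5 := Nat.mul_le_mul_left _ h5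
  have h8 : N ^ 8 = N ^ 3 * N ^ 5 := by ring
  constructor
  · intro tag i ht hi
    unfold MinSumVC.cell
    have h4 : 2 * N ^ 2 ≤ N * N ^ 2 := Nat.mul_le_mul_right _ h2
    have h7 : N * N ^ 2 = N ^ 3 := by ring
    have : 2 * N ≤ N ^ 2 := by nlinarith
    omega
  · omega

theorem Fits.lt_of_le {n m k w B a : ℕ} (h : Fits n m k w B)
    (ha : a ≤ 3 * (n + m + k + w + 2) ^ 2) : a < B := by
  refine lt_of_le_of_lt (ha.trans ?_) h.cube
  exact Nat.mul_le_mul_left _ (Nat.pow_le_pow_right (by omega) (by norm_num))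

theorem Fits.lt_of_le_linear {n m k w B a : ℕ} (h : Fits n m k w B)
    (ha : a ≤ 3 * (n + m + k + w + 2)) : a < B :=
  h.lt_of_le (ha.trans (Nat.mul_le_mul_left _ (Nat.le_self_pow (by norm_num) _)))

theorem Fits.cell_lt {n m k w B tag i : ℕ} (h : Fits n m k w B) (ht : tag < 8)
    (hi : i ≤ n + m + k + w + 2) : MinSumVC.cell m tag i < B :=
  h.cell _ _ ht (hi.trans (Nat.le_self_pow (by norm_num) _))

theorem Fits.adjacency_lt {n m k w B : ℕ} (h : Fits n m k w B) (x y : Fin n) :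
    MinSumVC.cell m adjacencyArray (x * n + y) < B := by
  refine h.cell _ _ (by norm_num) ?_
  have h1 : (x : ℕ) * n + y ≤ n * n := by nlinarith [x.2, y.2]
  exact h1.trans (by rw [sq]; exact Nat.mul_le_mul (by omega) (by omega))

theorem Fits.index_lt {n m k w B : ℕ} (h : Fits n m k w B) (x y : Fin n) : x * n + y < B := by
  refine h.lt_of_le ?_
  have h1 : (x : ℕ) * n + y ≤ n * n := by nlinarith [x.2, y.2]
  have h2 : n * n ≤ (n + m + k + w + 2) ^ 2 := by
    rw [sq]; exact Nat.mul_le_mul (by omega) (by omega)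
  omega

theorem Fits.mul_lt {n m k w B a b : ℕ} (h : Fits n m k w B) (ha : a ≤ n + m + k + w + 2)
    (hb : b ≤ n + m + k + w + 2) : a * b < B := by
  refine h.lt_of_le ?_
  have := Nat.mul_le_mul ha hb
  nlinarith

theorem adjacency_index_inj {n : ℕ} {x y u v : Fin n} :
    (x : ℕ) * n + y = u * n + v ↔ x = u ∧ y = v := by
  constructor
  · intro h
    have h1 := congrArg (· % n) h
    have h2 := congrArg (· / n) h
    have hn : 0 < n := x.pos
    simp only [Nat.mul_add_mod_self_right, Nat.mod_eq_of_lt y.2, Nat.mod_eq_of_lt v.2] at h1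
    rw [h1] at h
    exact ⟨Fin.ext (Nat.eq_of_mul_eq_mul_right hn (by omega)), Fin.ext h1⟩
  · rintro ⟨rfl, rfl⟩; rfl

/-! ### Building the degrees and the adjacency matrix. -/

/-- The memory contains the edges of the input. -/
def EdgeMemory {n : ℕ} (l : List (Fin n × Fin n)) (s : State) : Prop :=
  ∀ i (h : i < l.length), s.mem (2 * i) = l[i].1 ∧ s.mem (2 * i + 1) = l[i].2

/-- The memory contains the degrees and the adjacency matrix for the set `E` of edges. -/
structure GraphMemory {n : ℕ} (m : ℕ) (E : Finset (Sym2 (Fin n))) (s : State) : Prop where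
  degree : ∀ x : Fin n, s.mem (cell m degreeArray x) = edgeDegree E x
  adjacency : ∀ x y : Fin n,
    s.mem (cell m adjacencyArray (x * n + y)) = if s(x, y) ∈ E then 1 else 0

/-- The registers and the array for the kernel and the registers for the search are empty. -/
structure Fresh (n m : ℕ) (s : State) : Prop where
  count : s.reg rCount = 0
  depth : s.reg rDepth = 0
  cost : s.reg rCost = 0
  index : s.reg rIndex = 0
  mark : ∀ x : Fin n, s.mem (cell m markArray x) = 0

/-- The edges in a list. -/
def edgesOf {n : ℕ} (l : List (Fin n × Fin n)) : Finset (Sym2 (Fin n)) :=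
  (l.map fun p => s(p.1, p.2)).toFinset

theorem cell_ne_input {m tag i j : ℕ} (h : j < 2 * m) : j ≠ cell m tag i := by
  unfold cell; omega

theorem degreeBody_runs {n m k w B : ℕ} (hB : Fits n m k w B) {E : Finset (Sym2 (Fin n))}
    (hE : E.card ≤ m) {l : List (Fin n × Fin n)} (hl : l.length = m) {s : State} {i : ℕ} (hi : i < m)
    (hC : Constants n m k w s) (hM : EdgeMemory l s) (hG : GraphMemory m E s) (hF : Fresh n m s)
    (hI : s.reg rI = i) {u v : Fin n} (hu : l[i] = (u, v)) (huv : u ≠ v) (hn : s(u, v) ∉ E) :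
    Runs B (.seq readEdge <| .seq (bumpDegree rU) <| .seq (bumpDegree rV) <|
        .seq (markAdjacent rU rV) <| .seq (markAdjacent rV rU) (.arith .add rI rI rOne)) s
      fun s' t => (Constants n m k w s' ∧ EdgeMemory l s' ∧ GraphMemory m (insert s(u, v) E) s' ∧
        Fresh n m s' ∧ s'.reg rI = i + 1) ∧ t = 41 := by
  have h0 := (hM i (by omega)).1
  have h1 := (hM i (by omega)).2
  rw [hu] at h0 h1
  simp only [two_mul] at h0 h1
  have hd := edgeDegree_le_card E
  have hu2 := u.2
  have hv2 := v.2
  -- The degree of `v` is read after that of `u` has been incremented; since the ends differ, the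
  -- two cells do not interfere.
  have huv' : (v : ℕ) ≠ u := fun h => huv (Fin.ext h.symm)
  simp only [readEdge, bumpDegree, markAdjacent, runs_seq, runs_arith, runs_load, runs_getCell m,
    runs_putCell m, Op.eval, State.setReg_reg, State.setReg_mem, State.setMem_mem,
    State.setMem_reg, hI, hC.eight, hC.base, hC.one, hC.vertices, h0, h1, hG.degree,
    reduceIte, Nat.reduceEqDiff, ne_eq, not_false_eq_true, cell_inj, Nat.reduceLT, true_and, huv']
  have hdu := hd u
  have hdv := hd v
  and_intros
  any_goals first
    | exact hB.lt_of_le_linear (by omega)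
    | exact hB.cell_lt (by norm_num) (by omega)
    | exact hB.adjacency_lt _ _
    | exact hB.index_lt _ _
    | exact hB.mul_lt (by omega) (by omega)
    | trivial
  · constructor <;> simp [hC.vertices, hC.edges, hC.maxCost, hC.totalCost, hC.zero, hC.one,
      hC.eight, hC.base, hC.threshold]
  · intro j hj
    simp [cell_ne_input (show 2 * j < 2 * m by omega),
      cell_ne_input (show 2 * j + 1 < 2 * m by omega), hM j hj]
  · constructor
    · intro x
      rw [edgeDegree_insert huv hn]
      simp only [State.setReg_mem, State.setMem_mem, cell_inj, Nat.reduceLT, Fin.val_inj,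
        Nat.reduceEqDiff, false_and, true_and, reduceIte, hG.degree]
      by_cases hxu : x = u
      · subst hxu; simp [huv]
      · by_cases hxv : x = v
        · subst hxv; simp [hxu]
        · simp [hxu, hxv]
    · intro x y
      simp only [State.setReg_mem, State.setMem_mem, cell_inj, Nat.reduceLT, Fin.val_inj,
        Nat.reduceEqDiff, false_and, true_and, reduceIte, hG.adjacency, adjacency_index_inj,
        Finset.mem_insert, Sym2.eq_iff]
      by_cases h1 : x = u ∧ y = v
      · simp [h1]
      · by_cases h2 : x = v ∧ y = u <;> simp [h1, h2]
  · constructor <;> simp [hF.count, hF.depth, hF.cost, hF.index, hF.mark]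

theorem edgesOf_append_singleton {n : ℕ} (l : List (Fin n × Fin n)) (p : Fin n × Fin n) :
    edgesOf (l ++ [p]) = insert s(p.1, p.2) (edgesOf l) := by
  ext e; simp [edgesOf, or_comm]

theorem card_edgesOf_le {n : ℕ} (l : List (Fin n × Fin n)) : (edgesOf l).card ≤ l.length := by
  simpa [edgesOf] using List.toFinset_card_le (l.map fun p => s(p.1, p.2))

theorem degreeLoop_runs {n k w B : ℕ} {l : List (Fin n × Fin n)} (hB : Fits n l.length k w B)
    (hnd : (l.map fun p => s(p.1, p.2)).Nodup) (hne : ∀ p ∈ l, p.1 ≠ p.2)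
    (suf : List (Fin n × Fin n)) : ∀ (pre : List (Fin n × Fin n)) (s : State), l = pre ++ suf →
      Constants n l.length k w s → EdgeMemory l s → GraphMemory l.length (edgesOf pre) s →
      Fresh n l.length s → s.reg rI = pre.length → Runs B degreeLoop s fun s' t =>
        (Constants n l.length k w s' ∧ EdgeMemory l s' ∧ GraphMemory l.length (edgesOf l) s' ∧
          Fresh n l.length s') ∧ t ≤ 42 * suf.length + 1 := by
  induction suf with
  | nil =>
    intro pre s hl hC hM hG hF hI
    rw [List.append_nil] at hl
    subst hl
    exact Runs.loopStop (by simp [Test.Holds, hI, hC.edges]) ⟨⟨hC, hM, hG, hF⟩, by simp⟩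
  | cons p suf ih =>
    intro pre s hl hC hM hG hF hI
    have hlen : pre.length + (suf.length + 1) = l.length := by simp [hl]
    have hp : l[pre.length]'(by omega) = (p.1, p.2) := by simp [hl]
    have hcard := card_edgesOf_le pre
    -- No edge is listed twice, so incrementing the two degrees is correct for the enlarged edge
    -- set.
    have hnew : s(p.1, p.2) ∉ edgesOf pre := by
      rw [hl, List.map_append, List.nodup_append] at hnd
      intro h
      exact hnd.2.2 _ (List.mem_toFinset.1 h) s(p.1, p.2) (by simp) rfl
    refine Runs.loopStep (by simp [Test.Holds, hI, hC.edges]; omega) ?_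
    refine (degreeBody_runs hB (by omega) rfl (by omega) hC hM hG hF hI hp
      (hne p (by simp [hl])) hnew).mono ?_
    rintro s' t ⟨⟨hC', hM', hG', hF', hI'⟩, rfl⟩
    rw [← edgesOf_append_singleton] at hG'
    refine (ih (pre ++ [p]) s' (by simp [hl]) hC' hM' hG' hF' (by simp [hI'])).mono ?_
    rintro s'' t ⟨h, ht⟩
    refine ⟨h, ?_⟩
    simp only [List.length_cons]
    omega

/-! ### Building the kernel. -/

/-- The memory contains the list of the kernel vertices. -/
structure KernelMemory {n : ℕ} (m : ℕ) (X : List (Fin n)) (s : State) : Prop where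
  count : s.reg rCount = X.length
  list : ∀ j (h : j < X.length), s.mem (cell m kernelArray j) = X[j]
  mark : ∀ x : Fin n, s.mem (cell m markArray x) = if x ∈ X then 1 else 0
  nodup : X.Nodup

/-- The only changes from `s` to `s'` are in registers and arrays that the construction of the
kernel may use. -/
structure KernelFrame (m : ℕ) (s s' : State) : Prop where
  reg : ∀ y, y ≠ rCount → y ≠ rAddr → y ≠ rTag → y ≠ rTemp → s'.reg y = s.reg y
  mem : ∀ a, (∀ j, a ≠ cell m markArray j) → (∀ j, a ≠ cell m kernelArray j) → s'.mem a = s.mem a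

theorem KernelFrame.refl (m : ℕ) (s : State) : KernelFrame m s s := ⟨by simp, by simp⟩

theorem KernelFrame.constants {n m k w : ℕ} {s s' : State} (h : KernelFrame m s s')
    (hC : Constants n m k w s) : Constants n m k w s' := by
  constructor <;> rw [h.reg _ (by decide) (by decide) (by decide) (by decide)]
  exacts [hC.vertices, hC.edges, hC.maxCost, hC.totalCost, hC.zero, hC.one, hC.eight, hC.base,
    hC.threshold]

theorem KernelFrame.edgeMemory {n : ℕ} {l : List (Fin n × Fin n)} {s s' : State}
    (h : KernelFrame l.length s s') (hM : EdgeMemory l s) : EdgeMemory l s' := by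
  intro i hi
  rw [h.mem, h.mem]
  · exact hM i hi
  all_goals exact fun j => cell_ne_input (by omega)

theorem KernelFrame.graphMemory {n m : ℕ} {E : Finset (Sym2 (Fin n))} {s s' : State}
    (h : KernelFrame m s s') (hG : GraphMemory m E s) : GraphMemory m E s' := by
  constructor
  · intro x
    rw [h.mem _ (by simp) (by simp), hG.degree]
  · intro x y
    rw [h.mem _ (by simp) (by simp), hG.adjacency]

/-- The mark array makes the membership test take constant time. It also keeps the list free of
duplicates, so its length never exceeds `n`. -/
theorem addToKernel_runs {n m k w B : ℕ} (hB : Fits n m k w B) {X : List (Fin n)} {s : State}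
    (hC : Constants n m k w s) (hK : KernelMemory m X s) {x : ℕ} {u : Fin n} (hx : s.reg x = u)
    (h2 : x ≠ rAddr) (h3 : x ≠ rTag) (h4 : x ≠ rTemp) :
    Runs B (addToKernel x) s fun s' t =>
      (∃ X', KernelMemory m X' s' ∧ ∀ y, y ∈ X' ↔ y ∈ X ∨ y = u) ∧ KernelFrame m s s' ∧ t ≤ 18 := by
  have hlen : X.length ≤ n := by simpa using hK.nodup.length_le_card
  have hu := u.2
  simp only [addToKernel, runs_seq, runs_arith, runs_getCell m, runs_ite, Test.Holds, runs_skip,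
    runs_putCell m, Op.eval, State.setReg_reg, State.setReg_mem, State.setMem_mem,
    State.setMem_reg, hC.eight, hC.base, hC.one, hC.zero, hx, h2, h3, h4, hK.mark, hK.count,
    reduceIte, Nat.reduceEqDiff, ne_eq, not_false_eq_true, cell_inj, Nat.reduceLT, true_and]
  refine ⟨⟨hB.cell_lt (by norm_num) (by omega), ?_⟩, ?_, ?_⟩
  · split_ifs <;> exact hB.lt_of_le_linear (by omega)
  · intro hm
    have hm : u ∉ X := by simpa using hm
    and_intros
    any_goals first
      | exact hB.lt_of_le_linear (by omega)
      | exact hB.cell_lt (by norm_num) (by omega)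
    · refine ⟨X ++ [u], ⟨by simp, ?_, ?_, ?_⟩, by simp⟩
      · intro j hj
        simp only [State.setReg_mem, State.setMem_mem, cell_inj, Nat.reduceLT, Nat.reduceEqDiff,
          true_and, false_and, reduceIte]
        split_ifs with h
        · subst h; simp
        · have hj' : j < X.length := by simp at hj; omega
          rw [hK.list j hj', List.getElem_append_left hj']
      · intro y
        simp only [State.setReg_mem, State.setMem_mem, cell_inj, Nat.reduceLT, Nat.reduceEqDiff,
          true_and, false_and, reduceIte, hK.mark, Fin.val_inj, List.mem_append, List.mem_singleton]
        by_cases h : y = u <;> simp [h]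
      · exact hK.nodup.append (by simp) (by simpa using hm)
    · constructor
      · intro y h1 h2 h3 h4; simp [h1, h2, h3, h4]
      · intro a h1 h2; simp [h1, h2]
    · norm_num
  · intro hm
    have hm : u ∈ X := by by_contra h; simp [h] at hm
    refine ⟨⟨X, ⟨by simp [hK.count], by simpa using hK.list, by simpa using hK.mark, hK.nodup⟩, ?_⟩,
      ⟨?_, by simp⟩, by norm_num⟩
    · intro y; constructor
      · exact Or.inl
      · rintro (h | rfl); exacts [h, hm]
    · intro y h1 h2 h3 h4; simp [h2, h3, h4]

theorem considerVertex_runs {n m k w B : ℕ} (hB : Fits n m k w B) {X : List (Fin n)} {s : State}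
    (hC : Constants n m k w s) (hK : KernelMemory m X s) {x dx dy : ℕ} {u : Fin n}
    (hx : s.reg x = u) (h2 : x ≠ rAddr) (h3 : x ≠ rTag) (h4 : x ≠ rTemp) :
    Runs B (considerVertex x dx dy) s fun s' t =>
      (∃ X', KernelMemory m X' s' ∧
        ∀ y, y ∈ X' ↔ y ∈ X ∨ y = u ∧ (k * k + k < s.reg dx ∨ s.reg dy ≤ k * k + k)) ∧
      KernelFrame m s s' ∧ t ≤ 20 := by
  have h := addToKernel_runs hB hC hK hx h2 h3 h4
  simp only [considerVertex, runs_ite, runs_skip, Test.Holds, hC.threshold]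
  refine ⟨fun hd => h.mono ?_, fun hd => ⟨fun hd' => ?_, fun hd' => h.mono ?_⟩⟩
  · rintro s' t ⟨⟨X', hK', hX'⟩, hF, ht⟩
    exact ⟨⟨X', hK', by simpa [hd] using hX'⟩, hF, by omega⟩
  · exact ⟨⟨X, hK, by simp [hd, hd']⟩, .refl m s, by norm_num⟩
  · rintro s' t ⟨⟨X', hK', hX'⟩, hF, ht⟩
    exact ⟨⟨X', hK', by simpa [not_lt.1 hd'] using hX'⟩, hF, by omega⟩

/-- The registers for the search are empty. -/
structure SearchFresh (s : State) : Prop where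
  depth : s.reg rDepth = 0
  cost : s.reg rCost = 0
  index : s.reg rIndex = 0

theorem kernelBody_runs {n k w B : ℕ} {l : List (Fin n × Fin n)} (hB : Fits n l.length k w B)
    {E : Finset (Sym2 (Fin n))} (hE : E.card ≤ l.length) {s : State} {i : ℕ} (hi : i < l.length)
    (hC : Constants n l.length k w s) (hM : EdgeMemory l s) (hG : GraphMemory l.length E s)
    (hF : SearchFresh s) {X : List (Fin n)} (hK : KernelMemory l.length X s)
    (hI : s.reg rI = i) {u v : Fin n} (hu : l[i] = (u, v)) :
    Runs B (.seq readEdge <| .seq (getCell rDegU degreeArray rU) <|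
        .seq (getCell rDegV degreeArray rV) <| .seq (considerVertex rU rDegU rDegV) <|
        .seq (considerVertex rV rDegV rDegU) (.arith .add rI rI rOne)) s
      fun s' t => (Constants n l.length k w s' ∧ EdgeMemory l s' ∧ GraphMemory l.length E s' ∧
        SearchFresh s' ∧ s'.reg rI = i + 1 ∧ ∃ X', KernelMemory l.length X' s' ∧
          ∀ y, y ∈ X' ↔ y ∈ X ∨
            y = u ∧ (k * k + k < edgeDegree E u ∨ edgeDegree E v ≤ k * k + k) ∨
            y = v ∧ (k * k + k < edgeDegree E v ∨ edgeDegree E u ≤ k * k + k)) ∧ t ≤ 55 := by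
  have h0 := (hM i hi).1
  have h1 := (hM i hi).2
  rw [hu] at h0 h1
  simp only [two_mul] at h0 h1
  have hdu := edgeDegree_le_card E u
  have hdv := edgeDegree_le_card E v
  have hu2 := u.2
  have hv2 := v.2
  rw [readEdge]
  simp only [runs_seq, runs_arith, runs_load, runs_getCell l.length,
    Op.eval, State.setReg_reg, State.setReg_mem, hI, hC.eight, hC.base, hC.one, h0, h1, hG.degree,
    reduceIte, Nat.reduceEqDiff]
  and_intros
  any_goals first
    | exact hB.lt_of_le_linear (by omega)
    | exact hB.cell_lt (by norm_num) (by omega)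
  generalize hs' : State.setReg _ _ _ = s'
  have hC' : Constants n l.length k w s' := by
    subst hs'
    constructor <;> simp [hC.vertices, hC.edges, hC.maxCost, hC.totalCost, hC.zero, hC.one,
      hC.eight, hC.base, hC.threshold]
  have hM' : EdgeMemory l s' := by subst hs'; exact hM
  have hG' : GraphMemory l.length E s' := by subst hs'; exact ⟨hG.degree, hG.adjacency⟩
  have hK' : KernelMemory l.length X s' := by
    subst hs'; exact ⟨by simp [hK.count], hK.list, hK.mark, hK.nodup⟩
  have hF' : SearchFresh s' := by
    subst hs'; constructor <;> simp [hF.depth, hF.cost, hF.index]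
  have hr : s'.reg rU = u ∧ s'.reg rV = v ∧ s'.reg rDegU = edgeDegree E u ∧
      s'.reg rDegV = edgeDegree E v ∧ s'.reg rI = i := by
    subst hs'; simp [hI]
  clear hs'
  obtain ⟨hrU, hrV, hrDU, hrDV, hrI⟩ := hr
  refine (considerVertex_runs hB hC' hK' hrU (by decide) (by decide) (by decide)).mono ?_
  rintro s₁ t₁ ⟨⟨X₁, hK₁, hX₁⟩, hF₁, ht₁⟩
  have hr₁ := fun y h1 h2 h3 h4 => hF₁.reg y h1 h2 h3 h4
  refine (considerVertex_runs hB (hF₁.constants hC') hK₁ (x := rV) (u := v)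
    ((hF₁.reg _ (by decide) (by decide) (by decide) (by decide)).trans hrV)
    (by decide) (by decide) (by decide)).mono ?_
  rintro s₂ t₂ ⟨⟨X₂, hK₂, hX₂⟩, hF₂, ht₂⟩
  have hr₂ : ∀ y, y ≠ rCount → y ≠ rAddr → y ≠ rTag → y ≠ rTemp → s₂.reg y = s'.reg y :=
    fun y h1 h2 h3 h4 => (hF₂.reg y h1 h2 h3 h4).trans (hF₁.reg y h1 h2 h3 h4)
  have hC₂ := hF₂.constants (hF₁.constants hC')
  rw [hr₂ rI (by decide) (by decide) (by decide) (by decide), hrI, hC₂.one]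
  refine ⟨hB.lt_of_le_linear (by omega), ⟨?_, hF₂.edgeMemory (hF₁.edgeMemory hM'), ?_, ?_, by simp,
    X₂, ?_, ?_⟩, by omega⟩
  · constructor <;> simp [hC₂.vertices, hC₂.edges, hC₂.maxCost, hC₂.totalCost, hC₂.zero, hC₂.one,
      hC₂.eight, hC₂.base, hC₂.threshold]
  · have := hF₂.graphMemory (hF₁.graphMemory hG')
    exact ⟨this.degree, this.adjacency⟩
  · constructor <;> simp [hr₂, hF'.depth, hF'.cost, hF'.index]
  · exact ⟨by simp [hK₂.count], hK₂.list, hK₂.mark, hK₂.nodup⟩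
  · intro y
    rw [hX₂, hX₁, hr₁ rDegU (by decide) (by decide) (by decide) (by decide),
      hr₁ rDegV (by decide) (by decide) (by decide) (by decide), hrDU, hrDV, or_assoc]

/-- The invariant restricts the kernel condition to edges already read, but measures degrees in the
whole graph, since these were computed before. After the last edge it is `IsKernel`. -/
theorem kernelLoop_runs {n k w B : ℕ} {l : List (Fin n × Fin n)} (hB : Fits n l.length k w B)
    (suf : List (Fin n × Fin n)) : ∀ (pre : List (Fin n × Fin n)) (s : State) (X : List (Fin n)),
      l = pre ++ suf → Constants n l.length k w s → EdgeMemory l s →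
      GraphMemory l.length (edgesOf l) s → SearchFresh s → KernelMemory l.length X s →
      (∀ x, x ∈ X ↔ ∃ u, s(x, u) ∈ edgesOf pre ∧
        (k * k + k < edgeDegree (edgesOf l) x ∨ edgeDegree (edgesOf l) u ≤ k * k + k)) →
      s.reg rI = pre.length → Runs B kernelLoop s fun s' t =>
        (Constants n l.length k w s' ∧ GraphMemory l.length (edgesOf l) s' ∧ SearchFresh s' ∧
          ∃ X, KernelMemory l.length X s' ∧ IsKernel (edgesOf l) (k * k + k) X) ∧
        t ≤ 56 * suf.length + 1 := by
  induction suf with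
  | nil =>
    intro pre s X hl hC hM hG hF hK hX hI
    rw [List.append_nil] at hl
    subst hl
    exact Runs.loopStop (by simp [Test.Holds, hI, hC.edges]) ⟨⟨hC, hG, hF, X, hK, hX⟩, by simp⟩
  | cons p suf ih =>
    intro pre s X hl hC hM hG hF hK hX hI
    have hlen : pre.length + (suf.length + 1) = l.length := by simp [hl]
    have hp : l[pre.length]'(by omega) = (p.1, p.2) := by simp [hl]
    refine Runs.loopStep (by simp [Test.Holds, hI, hC.edges]; omega) ?_
    refine (kernelBody_runs hB (card_edgesOf_le l) (by omega) hC hM hG hF hK hI hp).mono ?_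
    rintro s' t ⟨⟨hC', hM', hG', hF', hI', X', hK', hX'⟩, ht⟩
    refine (ih (pre ++ [p]) s' X' (by simp [hl]) hC' hM' hG' hF' hK' ?_ (by simp [hI'])).mono ?_
    · intro x
      rw [hX', hX, edgesOf_append_singleton]
      simp only [Finset.mem_insert, or_and_right, exists_or, Sym2.eq_iff]
      rw [or_comm]
      refine or_congr ?_ Iff.rfl
      constructor
      · rintro (⟨rfl, h⟩ | ⟨rfl, h⟩)
        · exact Or.inl ⟨p.2, ⟨rfl, rfl⟩, h⟩
        · exact Or.inr ⟨p.1, ⟨rfl, rfl⟩, h⟩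
      · rintro (⟨u, ⟨rfl, rfl⟩, h⟩ | ⟨u, ⟨rfl, rfl⟩, h⟩)
        · exact Or.inl ⟨rfl, h⟩
        · exact Or.inr ⟨rfl, h⟩
    · rintro s'' t' ⟨h, ht'⟩
      refine ⟨h, ?_⟩
      simp only [List.length_cons]
      omega

end MinSumVC

/-! ## The search -/

namespace RAM

/-- The loop gets from `s` to `s'` in `t` steps. -/
def Reaches (B : ℕ) (b : Test) (p : Prog) (s s' : State) (t : ℕ) : Prop :=
  ∀ s'' t', Exec B (.loop b p) s' s'' t' → Exec B (.loop b p) s s'' (t + t')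

variable {B : ℕ} {b : Test} {p : Prog} {s s' s'' : State} {t t' : ℕ}

theorem Reaches.refl : Reaches B b p s s 0 := fun s'' t' h => by rwa [zero_add]

theorem Reaches.trans (h : Reaches B b p s s' t) (h' : Reaches B b p s' s'' t') :
    Reaches B b p s s'' (t + t') := fun _ _ hx => by
  rw [add_assoc]; exact h _ _ (h' _ _ hx)

theorem Reaches.step (hb : b.Holds s) (h : Exec B p s s' t) : Reaches B b p s s' (t + 1) :=
  fun _ t' hx => by
    rw [add_right_comm]; exact .loopStep hb h hx

theorem Reaches.runs {Q : State → ℕ → Prop} (h : Reaches B b p s s' t)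
    (h' : Runs B (.loop b p) s' fun s'' t' => Q s'' (t + t')) : Runs B (.loop b p) s Q :=
  let ⟨_, _, hx, hq⟩ := h'
  ⟨_, _, h _ _ hx, hq⟩

end RAM

namespace MinSumVC

open RAM

/-! ### Degrees after the deletion of the vertices on the stack. -/

section Remaining

variable {V : Type*} [DecidableEq V]

/-- The edges that are left after the deletion of the vertices on a stack. -/
def remaining (E : Finset (Sym2 V)) : List V → Finset (Sym2 V)
  | [] => E
  | x :: L => del (remaining E L) x

theorem mem_remaining {E : Finset (Sym2 V)} {L : List V} {e : Sym2 V} :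
    e ∈ remaining E L ↔ e ∈ E ∧ ∀ v ∈ L, v ∉ e := by
  induction L with
  | nil => simp [remaining]
  | cons v L ih => simp [remaining, ih]; tauto

theorem card_remaining_le (E : Finset (Sym2 V)) (L : List V) : (remaining E L).card ≤ E.card :=
  Finset.card_le_card fun _ he => (mem_remaining.1 he).1

/-- The computation of the degree of `x` without the vertices on a stack, starting with `g`. -/
def residual (E : Finset (Sym2 V)) (x : V) (g : ℕ) (L : List V) : ℕ :=
  L.foldl (fun g y => if y = x then 0 else g - if s(x, y) ∈ E then 1 else 0) g

/-- The machine processes the stack from the top, whereas `remaining` deletes its top last. The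
updates commute, because truncated subtraction keeps a degree that was set to zero at zero. -/
theorem residual_cons (E : Finset (Sym2 V)) (x y : V) (L : List V) : ∀ g, residual E x g (y :: L) =
    if y = x then 0 else residual E x g L - if s(x, y) ∈ E then 1 else 0 := by
  induction L with
  | nil => intro g; simp [residual]
  | cons z L ih =>
    intro g
    have h1 : residual E x g (y :: z :: L) = residual E x (if z = x then 0 else
        g - if s(x, z) ∈ E then 1 else 0) (y :: L) := by
      simp only [residual, List.foldl_cons]
      congr 1
      split_ifs <;> omega
    rw [h1, ih]
    rfl

theorem residual_eq [Fintype V] (E : Finset (Sym2 V)) (x : V) {L : List V} (hL : L.Nodup) :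
    residual E x (edgeDegree E x) L = edgeDegree (remaining E L) x := by
  induction L with
  | nil => rfl
  | cons y L ih =>
    obtain ⟨hy, hL⟩ := List.nodup_cons.1 hL
    rw [residual_cons, ih hL, remaining]
    split_ifs with h1 h2
    · rw [h1, edgeDegree_del_self]
    · rw [edgeDegree_del_of_ne _ h1]
      -- Adjacency is looked up in `E`, not in the remaining edges. If `x` was deleted, the degree
      -- is zero and truncation hides the difference; otherwise neither end was deleted, as the
      -- stack has no repetition.
      by_cases hx : x ∈ L
      · have : edgeDegree (remaining E L) x = 0 := by
          refine Nat.eq_zero_of_not_pos fun h => ?_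
          obtain ⟨z, hz⟩ := edgeDegree_pos.1 h
          exact (mem_remaining.1 hz).2 x hx (by simp)
        omega
      · rw [if_pos]
        refine mem_remaining.2 ⟨h2, fun v hv hve => ?_⟩
        rcases Sym2.mem_iff.1 hve with rfl | rfl
        exacts [hx hv, hy hv]
    · rw [edgeDegree_del_of_ne _ h1, if_neg fun h => h2 (mem_remaining.1 h).1]

end Remaining

variable {n m k w B : ℕ} {E : Finset (Sym2 (Fin n))} {X : List (Fin n)}

/-! ### The invariant at a node of the search tree and single steps of the search. -/

/-- The vertices on a stack. -/
abbrev stackVertices (St : List (Fin n × ℕ)) : List (Fin n) := St.map Prod.fst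

/-- The memory contains a stack of vertices with their numbers in the kernel. -/
def StackMemory (m : ℕ) (E : Finset (Sym2 (Fin n))) : List (Fin n × ℕ) → (ℕ → ℕ) → Prop
  | [], _ => True
  | (x, i) :: St, mem => mem (cell m vertexStack St.length) = x ∧
      mem (cell m indexStack St.length) = i ∧
      mem (cell m edgesStack St.length) = (remaining E (stackVertices St)).card ∧
      StackMemory m E St mem

theorem StackMemory.congr {mem mem' : ℕ → ℕ} : ∀ {St : List (Fin n × ℕ)},
    StackMemory m E St mem → (∀ t j, t < 8 → j < St.length → mem' (cell m t j) = mem (cell m t j)) →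
      StackMemory m E St mem'
  | [], _, _ => trivial
  | (x, i) :: St, ⟨h1, h2, h3, h4⟩, h => by
    refine ⟨?_, ?_, ?_, h4.congr fun t j ht hj => h t j ht (by simp; omega)⟩
    · rw [h _ _ (by norm_num) (by simp), h1]
    · rw [h _ _ (by norm_num) (by simp), h2]
    · rw [h _ _ (by norm_num) (by simp), h3]

/-- The search is at a node of the search tree, which is given by a stack. The costs so far are
`c`, and the next child is given by the kernel vertex with the number `i`. -/
structure AtNode (n m k w : ℕ) (E : Finset (Sym2 (Fin n))) (X : List (Fin n))
    (St : List (Fin n × ℕ)) (c i : ℕ) (s : State) : Prop where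
  constants : Constants n m k w s
  graph : GraphMemory m E s
  kernel : KernelMemory m X s
  stack : StackMemory m E St s.mem
  depth : s.reg rDepth = St.length
  edges : s.reg rEdges = (remaining E (stackVertices St)).card
  cost : s.reg rCost = c
  index : s.reg rIndex = i
  run : s.reg rRun = 1
  nodup : (stackVertices St).Nodup
  depth_le : St.length ≤ k
  cost_le : c ≤ St.length * m

/-- The node has no children that have not been visited. -/
def Exhausted (k w : ℕ) (E : Finset (Sym2 (Fin n))) (X : List (Fin n)) (St : List (Fin n × ℕ))
    (c i : ℕ) : Prop :=
  remaining E (stackVertices St) = ∅ ∧ w < c ∨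
    remaining E (stackVertices St) ≠ ∅ ∧ (St.length = k ∨ i = X.length)

/-- The persistent state of the search is in the registers below `14`, apart from the threshold. The
frame condition therefore lists those, the threshold and the vertex under test. -/
theorem residualLoop_runs (hB : Fits n m k w B) {x : Fin n} (St : List (Fin n × ℕ)) :
    ∀ (s : State) (g : ℕ), Constants n m k w s → GraphMemory m E s → StackMemory m E St s.mem →
      St.length ≤ k → s.reg rU = x → s.reg rDegU = g → g ≤ m → s.reg rI = St.length →
      Runs B residualLoop s fun s' t => (s'.mem = s.mem ∧
        s'.reg rDegU = residual E x g (stackVertices St) ∧ (∀ y, y < 14 → s'.reg y = s.reg y) ∧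
        s'.reg rU = x ∧ s'.reg rThreshold = s.reg rThreshold) ∧ t ≤ 17 * St.length + 1 := by
  induction St with
  | nil =>
    intro s g hC hG hS _ hU hD hg hI
    exact Runs.loopStop (by simp [Test.Holds, hI, hC.zero])
      ⟨⟨rfl, hD, fun _ _ => rfl, hU, rfl⟩, by simp⟩
  | cons p St ih =>
    obtain ⟨y, i⟩ := p
    intro s g hC hG hS hk hU hD hg hI
    obtain ⟨hv, -, -, hS⟩ := hS
    have hx2 := x.2
    have hy2 := y.2
    rw [List.length_cons] at hI hk
    refine Runs.loopStep (by simp [Test.Holds, hI, hC.zero]) ?_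
    have hadj : (if s(x, y) ∈ E then 1 else 0) ≤ 1 := by split_ifs <;> simp
    simp only [runs_seq, runs_arith, runs_const, runs_getCell m, runs_ite, Test.Holds, Op.eval,
      State.setReg_reg, State.setReg_mem, hI, hU, hD, hv, hC.eight, hC.base, hC.one, hC.vertices,
      hG.adjacency, reduceIte, Nat.reduceEqDiff, Nat.add_sub_cancel, Fin.val_inj]
    refine ⟨hB.lt_of_le_linear (by omega), ⟨hB.cell_lt (by norm_num) (by omega),
      hB.lt_of_le_linear (by omega)⟩, fun hxy => ⟨hB.lt_of_le_linear (by omega), ?_⟩, fun hxy => ?_⟩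
    · refine Runs.mono (ih _ 0 ?_ ⟨hG.degree, hG.adjacency⟩ hS (by omega) (by simp [hU]) (by simp)
        (by omega) (by simp)) ?_
      · constructor <;> simp [hC.vertices, hC.edges, hC.maxCost, hC.totalCost, hC.zero, hC.one,
          hC.eight, hC.base, hC.threshold]
      · rintro s' t ⟨⟨h1, h2, h3, h4, h5⟩, ht⟩
        refine ⟨⟨h1, ?_, ?_, h4, by simpa using h5⟩, by simp only [List.length_cons]; omega⟩
        · rw [h2]; simp [residual, hxy]
        · intro z hz
          rw [h3 z hz]
          simp only [State.setReg_reg]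
          repeat rw [if_neg (by omega)]
    · and_intros
      any_goals first
        | exact hB.lt_of_le_linear (by omega)
        | exact hB.adjacency_lt _ _
        | exact hB.index_lt _ _
        | exact hB.mul_lt (by omega) (by omega)
      refine Runs.mono (ih _ _ ?_ ⟨hG.degree, hG.adjacency⟩ hS (by omega) (by simp [hU])
        (by simp only [State.setReg_reg, reduceIte]; rfl) (by omega) (by simp)) ?_
      · constructor <;> simp [hC.vertices, hC.edges, hC.maxCost, hC.totalCost, hC.zero, hC.one,
          hC.eight, hC.base, hC.threshold]
      · rintro s' t ⟨⟨h1, h2, h3, h4, h5⟩, ht⟩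
        refine ⟨⟨h1, ?_, ?_, h4, by simpa using h5⟩, by simp only [List.length_cons]; omega⟩
        · rw [h2]; simp [residual, hxy]
        · intro z hz
          rw [h3 z hz]
          simp only [State.setReg_reg]
          repeat rw [if_neg (by omega)]

/-- Each stack entry stores the number of edges at its parent, so the subtraction undoes exactly the
cost added on entering the child. The bound on `c` makes the restored cost fit into a word. -/
theorem popNode_runs (hB : Fits n m k w B) (hE : E.card ≤ m) {x : Fin n} {St : List (Fin n × ℕ)}
    {c i j : ℕ} {s : State} (h : AtNode n m k w E X ((x, i) :: St)
      (c + (remaining E (stackVertices St)).card) j s) (hi : i < X.length) (hc : c ≤ St.length * m) :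
    Runs B popNode s fun s' t => AtNode n m k w E X St c (i + 1) s' ∧ t ≤ 17 := by
  obtain ⟨-, hv, he, hS⟩ := h.stack
  have hlen : X.length ≤ n := by simpa using h.kernel.nodup.length_le_card
  have hcard := card_remaining_le E (stackVertices St)
  have hd := h.depth_le
  have hC := h.constants
  have hK := h.kernel
  rw [List.length_cons] at hd
  have hcB : c < B := by
    refine (hc.trans_lt (hB.mul_lt (by omega) (by omega)))
  simp only [popNode, runs_seq, runs_arith, runs_const, runs_getCell m, runs_ite, Test.Holds,
    Op.eval, State.setReg_reg, State.setReg_mem, h.depth, List.length_cons, h.cost, hC.zero, hv, he,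
    hC.eight, hC.base, hC.one, reduceIte, Nat.reduceEqDiff, Nat.add_sub_cancel]
  refine ⟨fun h => h.elim, fun _ => ?_⟩
  and_intros
  any_goals first
    | exact hB.lt_of_le_linear (by omega)
    | exact hB.cell_lt (by norm_num) (by omega)
    | exact hcB
  · exact
    { constants := by constructor <;> simp [hC.vertices, hC.edges, hC.maxCost, hC.totalCost,
        hC.zero, hC.one, hC.eight, hC.base, hC.threshold]
      graph := ⟨h.graph.degree, h.graph.adjacency⟩
      kernel := ⟨by simp [hK.count], hK.list, hK.mark, hK.nodup⟩
      stack := hS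
      depth := by simp
      edges := by simp
      cost := by simp
      index := by simp
      run := by simp [h.run]
      nodup := (List.nodup_cons.1 h.nodup).2
      depth_le := by omega
      cost_le := hc }
  · norm_num

/-- The slack of `3` covers the tests made before `popNode` is reached. -/
theorem searchStep_pop {Q : State → ℕ → Prop} {St : List (Fin n × ℕ)} {c i : ℕ} {s : State}
    (h : AtNode n m k w E X St c i s) (hx : Exhausted k w E X St c i)
    (hp : Runs B popNode s fun s' t => ∀ t', t' ≤ t + 3 → Q s' t') : Runs B searchStep s Q := by
  simp only [searchStep, runs_ite, Test.Holds, h.edges, h.constants.zero, h.constants.totalCost,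
    h.cost, h.depth, h.constants.maxCost, h.index, h.kernel.count, Finset.card_eq_zero]
  refine ⟨fun h0 => ⟨fun _ => hp.mono fun s' t h => h _ (by omega), fun h1 => ?_⟩,
    fun h0 => ⟨fun _ => hp.mono fun s' t h => h _ (by omega),
      fun h1 => ⟨fun _ => hp.mono fun s' t h => h _ (by omega), fun h2 => ?_⟩⟩⟩
  · rcases hx with hx | hx
    exacts [absurd hx.2 h1, absurd h0 hx.1]
  · rcases hx with hx | ⟨-, hx | hx⟩
    exacts [absurd hx.1 h0, absurd hx h1, absurd hx h2]

theorem searchStep_accept (hB : Fits n m k w B) {St : List (Fin n × ℕ)} {c i : ℕ} {s : State}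
    (h : AtNode n m k w E X St c i s) (h0 : remaining E (stackVertices St) = ∅) (hc : c ≤ w) :
    Runs B searchStep s fun s' t => s'.reg rN = 1 ∧ s'.reg rRun ≠ s'.reg rOne ∧ t ≤ 4 := by
  simp only [searchStep, answer, runs_ite, runs_seq, runs_const, Test.Holds, h.edges,
    h.constants.zero, h.constants.totalCost, h.cost, h0, Finset.card_empty]
  refine ⟨fun _ => ⟨fun h => by omega, fun _ => ⟨hB.lt_of_le_linear (by omega),
    hB.lt_of_le_linear (by omega), by simp, by simp [h.constants.one], by norm_num⟩⟩,
    fun h => absurd trivial h⟩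

theorem searchStep_reject (hB : Fits n m k w B) {c i : ℕ} {s : State}
    (h : AtNode n m k w E X [] c i s) (hx : Exhausted k w E X [] c i) :
    Runs B searchStep s fun s' t => s'.reg rN = 0 ∧ s'.reg rRun ≠ s'.reg rOne ∧ t ≤ 6 := by
  refine searchStep_pop h hx ?_
  simp only [popNode, answer, runs_ite, runs_seq, runs_const, Test.Holds, h.depth,
    h.constants.zero, List.length_nil]
  exact ⟨fun _ => ⟨hB.lt_of_le_linear (by omega), hB.lt_of_le_linear (by omega),
    fun t ht => ⟨by simp, by simp [h.constants.one], by omega⟩⟩, fun h => absurd trivial h⟩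

/-- One step either descends to a child or moves on to the next kernel vertex; computing the
residual degree dominates its time. A vertex passing the test has positive residual degree, so it is
not on the stack yet. -/
theorem searchStep_try (hB : Fits n m k w B) (hE : E.card ≤ m) {St : List (Fin n × ℕ)} {c i : ℕ}
    {s : State} (h : AtNode n m k w E X St c i s) (h0 : remaining E (stackVertices St) ≠ ∅)
    (hd : St.length < k) (hi : i < X.length) :
    Runs B searchStep s fun s' t => t ≤ 17 * k + 40 ∧
      if (remaining E (stackVertices St)).card ≤
          (k - St.length) * edgeDegree (remaining E (stackVertices St)) X[i]
      then AtNode n m k w E X ((X[i], i) :: St) (c + (remaining E (stackVertices St)).card) 0 s'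
      else AtNode n m k w E X St c (i + 1) s' := by
  have hlen : X.length ≤ n := by simpa using h.kernel.nodup.length_le_card
  have hcard := card_remaining_le E (stackVertices St)
  have hC := h.constants
  have hK := h.kernel
  have hx2 := X[i].2
  have hdeg := edgeDegree_le_card E X[i]
  have hdeg' := edgeDegree_le_card (remaining E (stackVertices St)) X[i]
  have hcm : c + (remaining E (stackVertices St)).card ≤ (St.length + 1) * m := by
    rw [add_mul, one_mul]; exact add_le_add h.cost_le (hcard.trans hE)
  have hcB := hcm.trans_lt (hB.mul_lt (a := St.length + 1) (b := m) (by omega) (by omega))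
  simp only [searchStep, tryVertex, runs_ite, runs_seq, runs_copy, runs_getCell m, Test.Holds,
    State.setReg_reg, State.setReg_mem, hC.eight, hC.base,
    h.edges, hC.zero, hC.totalCost, h.graph.degree, hK.list _ hi,
    h.cost, h.depth, hC.maxCost, h.index, hK.count, Finset.card_eq_zero, reduceIte,
    Nat.reduceEqDiff]
  refine ⟨fun h => absurd h h0, fun _ => ⟨fun h => by omega, fun _ => ⟨fun h => by omega,
    fun _ => ?_⟩⟩⟩
  refine ⟨⟨hB.cell_lt (by norm_num) (by omega), hB.lt_of_le_linear (by omega)⟩,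
    ⟨hB.cell_lt (by norm_num) (by omega), hB.lt_of_le_linear (by omega)⟩,
    hB.lt_of_le_linear (by omega), ?_⟩
  refine Runs.mono (residualLoop_runs hB (E := E) (x := X[i]) St _ (edgeDegree E X[i]) ?_
    ⟨h.graph.degree, h.graph.adjacency⟩ h.stack hd.le (by simp) (by simp) (hdeg.trans hE)
    (by simp)) ?_
  · constructor <;> simp [hC.vertices, hC.edges, hC.maxCost, hC.totalCost, hC.zero, hC.one,
      hC.eight, hC.base, hC.threshold]
  rintro s' t ⟨⟨hmem, hD, hreg, hU, hT⟩, ht⟩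
  rw [residual_eq _ _ h.nodup] at hD
  simp only [State.setReg_mem] at hmem
  have hreg' : ∀ y, y < 14 → s'.reg y = s.reg y := by
    intro y hy
    rw [hreg y hy]
    simp only [State.setReg_reg]
    repeat rw [if_neg (by omega)]
  have hT : s'.reg rThreshold = s.reg rThreshold := by rw [hT]; simp
  clear hreg
  have h' : AtNode n m k w E X St c i s' :=
    { constants := by
        constructor <;> simp [hreg', hT, hC.vertices, hC.edges, hC.maxCost, hC.totalCost,
          hC.zero, hC.one, hC.eight, hC.base, hC.threshold]
      graph := ⟨by rw [hmem]; exact h.graph.degree, by rw [hmem]; exact h.graph.adjacency⟩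
      kernel := ⟨by simp [hreg', hK.count], by rw [hmem]; exact hK.list,
        by rw [hmem]; exact hK.mark, hK.nodup⟩
      stack := by rw [hmem]; exact h.stack
      depth := by simp [hreg', h.depth]
      edges := by simp [hreg', h.edges]
      cost := by simp [hreg', h.cost]
      index := by simp [hreg', h.index]
      run := by simp [hreg', h.run]
      nodup := h.nodup
      depth_le := h.depth_le
      cost_le := h.cost_le }
  clear h hreg' hT hmem hC hK
  have hC := h'.constants
  have hK := h'.kernel
  have hS := h'.stack
  have hG := h'.graph
  simp only [pushNode, runs_ite, runs_seq, runs_arith, runs_const, runs_putCell m, Test.Holds,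
    Op.eval, State.setReg_reg, State.setReg_mem, State.setMem_reg, State.setMem_mem, hC.eight,
    hC.base, hC.one, hC.maxCost, h'.edges, h'.index, h'.cost, h'.depth, hD, hU,
    reduceIte, Nat.reduceEqDiff, ne_eq, not_false_eq_true]
  refine ⟨hB.lt_of_le_linear (by omega), hB.mul_lt (by omega) (by omega), fun hlt => ?_,
    fun hge => ?_⟩
  · refine ⟨hB.lt_of_le_linear (by omega), by omega, ?_⟩
    rw [if_neg (by omega)]
    exact
      { constants := by
          constructor <;> simp [hC.vertices, hC.edges, hC.maxCost, hC.totalCost,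
            hC.zero, hC.one, hC.eight, hC.base, hC.threshold]
        graph := ⟨hG.degree, hG.adjacency⟩
        kernel := ⟨by simp [hK.count], hK.list, hK.mark, hK.nodup⟩
        stack := hS
        depth := by simp [h'.depth]
        edges := by simp [h'.edges]
        cost := by simp [h'.cost]
        index := by simp
        run := by simp [h'.run]
        nodup := h'.nodup
        depth_le := h'.depth_le
        cost_le := h'.cost_le }
  · and_intros
    any_goals first
      | exact hB.lt_of_le_linear (by omega)
      | exact hB.cell_lt (by norm_num) (by omega)
      | exact hcB
      | omega
    rw [if_pos (by omega)]
    have hpos : 0 < edgeDegree (remaining E (stackVertices St)) X[i] := by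
      refine Nat.pos_of_ne_zero fun h => h0 (Finset.card_eq_zero.1 ?_)
      rw [h] at hge; omega
    have hnew : X[i] ∉ stackVertices St := by
      intro hm
      obtain ⟨y, hy⟩ := edgeDegree_pos.1 hpos
      exact (mem_remaining.1 hy).2 _ hm (by simp)
    exact
      { constants := by
          constructor <;> simp [hC.vertices, hC.edges, hC.maxCost, hC.totalCost,
            hC.zero, hC.one, hC.eight, hC.base, hC.threshold]
        graph := ⟨by simp [hG.degree], by simp [hG.adjacency]⟩
        kernel := ⟨by simp [hK.count], by simpa using hK.list, by simpa using hK.mark, hK.nodup⟩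
        stack := by
          refine ⟨by simp, by simp, by simp, hS.congr fun t j ht hj => ?_⟩
          simp [ht, hj.ne]
        depth := by simp
        edges := by
          have := card_del_add_edgeDegree (remaining E (stackVertices St)) X[i]
          simp only [State.setReg_reg, State.setMem_reg, Nat.reduceEqDiff, reduceIte]
          change _ = (del (remaining E (stackVertices St)) X[i]).card
          omega
        cost := by simp
        index := by simp
        run := by simp [h'.run]
        nodup := List.nodup_cons.2 ⟨hnew, h'.nodup⟩
        depth_le := by simp; omega
        cost_le := by simpa using hcm }

/-! ### The recurrence for the running time. -/

/-- The time for one step of the search. -/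
def stepTime (k : ℕ) : ℕ := 17 * k + 41

/-- The time for a node of the search tree above which there are `r` levels. -/
def nodeTime (k q : ℕ) : ℕ → ℕ
  | 0 => stepTime k
  | r + 1 => q * stepTime k + 2 * (r + 1) * (nodeTime k q r + stepTime k)

theorem stepTime_le_nodeTime (k q r : ℕ) : stepTime k ≤ nodeTime k q r := by
  cases r with
  | zero => exact le_rfl
  | succ r =>
    rw [nodeTime]
    have : 1 * stepTime k ≤ 2 * (r + 1) * (nodeTime k q r + stepTime k) :=
      Nat.mul_le_mul (by omega) (by omega)
    omega

/-- The summand `(q + 2) * stepTime k` on the left absorbs the additive terms of the recurrence: the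
sum then grows at most by the factor `2 * (r + 1)` per level, which multiplies up to `2 ^ r * r!`.
-/
theorem nodeTime_add_le (k q r : ℕ) : nodeTime k q r + (q + 2) * stepTime k ≤
    (q + 2) * stepTime k * (2 * (2 ^ r * r.factorial)) := by
  induction r with
  | zero => simp [nodeTime]; nlinarith
  | succ r ih =>
    rw [nodeTime, pow_succ, Nat.factorial_succ]
    have h := Nat.mul_le_mul_left (2 * (r + 1)) ih
    have h2 : q * stepTime k + 2 * (r + 1) * stepTime k + (q + 2) * stepTime k ≤
        2 * (r + 1) * ((q + 2) * stepTime k) := by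
      have : q + 2 * (r + 1) + (q + 2) ≤ 2 * (r + 1) * (q + 2) := by nlinarith
      calc _ = (q + 2 * (r + 1) + (q + 2)) * stepTime k := by ring
        _ ≤ 2 * (r + 1) * (q + 2) * stepTime k := Nat.mul_le_mul_right _ this
        _ = _ := by ring
    calc _ = 2 * (r + 1) * nodeTime k q r +
          (q * stepTime k + 2 * (r + 1) * stepTime k + (q + 2) * stepTime k) := by ring
      _ ≤ 2 * (r + 1) * nodeTime k q r + 2 * (r + 1) * ((q + 2) * stepTime k) :=
          Nat.add_le_add_left h2 _
      _ = 2 * (r + 1) * (nodeTime k q r + (q + 2) * stepTime k) := by ring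
      _ ≤ _ := h
      _ = _ := by ring

/-! ### Traversal of the search tree. -/

/-- Within `T` steps the search halts with the answer yes, if `P` holds, and completes the visit of
the node otherwise. -/
def Visits (n m k w B : ℕ) (E : Finset (Sym2 (Fin n))) (X : List (Fin n)) (St : List (Fin n × ℕ))
    (c : ℕ) (s : State) (P : Prop) (T : ℕ) : Prop :=
  (P → Runs B searchLoop s fun s' t => s'.reg rN = 1 ∧ t ≤ T) ∧
    (¬ P → ∃ i s' t, Reaches B (.eq rRun rOne) searchStep s s' t ∧ AtNode n m k w E X St c i s' ∧
      Exhausted k w E X St c i ∧ t ≤ T)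

theorem AtNode.holds {St : List (Fin n × ℕ)} {c i : ℕ} {s : State}
    (h : AtNode n m k w E X St c i s) : (Test.eq rRun rOne).Holds s := by
  simp [Test.Holds, h.run, h.constants.one]

/-- Induction over the kernel vertices not yet tried. Each costs one step for the test; one that
passes also costs a visit of its subtree and one step for the return, so only the number of
candidates multiplies `T`. -/
theorem visits_children (hB : Fits n m k w B) (hE : E.card ≤ m) {St : List (Fin n × ℕ)} {c T : ℕ}
    (h0 : remaining E (stackVertices St) ≠ ∅) (hd : St.length < k) (hc : c ≤ St.length * m)
    (S : Fin n → Prop)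
    (hS : ∀ x i s, AtNode n m k w E X ((x, i) :: St) (c + (remaining E (stackVertices St)).card) 0 s →
      Visits n m k w B E X ((x, i) :: St) (c + (remaining E (stackVertices St)).card) s (S x) T)
    (suf : List (Fin n)) : ∀ (pre : List (Fin n)) (s : State), X = pre ++ suf →
      AtNode n m k w E X St c pre.length s →
      Visits n m k w B E X St c s
        (∃ x ∈ suf, (remaining E (stackVertices St)).card ≤
          (k - St.length) * edgeDegree (remaining E (stackVertices St)) x ∧ S x)
        (suf.length * stepTime k + (suf.countP fun x => (remaining E (stackVertices St)).card ≤
          (k - St.length) * edgeDegree (remaining E (stackVertices St)) x) * (T + stepTime k)) := by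
  induction suf with
  | nil =>
    intro pre s hX h
    refine ⟨by simp, fun _ => ⟨pre.length, s, 0, .refl, h, Or.inr ⟨h0, Or.inr ?_⟩, by simp⟩⟩
    rw [hX, List.append_nil]
  | cons x suf ih =>
    intro pre s hX h
    have hi : pre.length < X.length := by simp [hX]
    have hx : X[pre.length] = x := by simp [hX]
    obtain ⟨s₁, t₁, hrun, ht₁, hs₁⟩ := searchStep_try hB hE h h0 hd hi
    rw [hx] at hs₁
    have hR := Reaches.step h.holds hrun
    have ht₁ : t₁ + 1 ≤ stepTime k := by unfold stepTime; omega
    have hnext := fun s' hs' => ih (pre ++ [x]) s' (by simp [hX]) hs'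
    rw [List.length_append, List.length_singleton] at hnext
    by_cases hcand : (remaining E (stackVertices St)).card ≤
        (k - St.length) * edgeDegree (remaining E (stackVertices St)) x
    · rw [if_pos hcand] at hs₁
      simp only [List.length_cons, List.countP_cons, hcand, decide_true, if_true]
      simp only [add_mul, one_mul]
      obtain ⟨hyes, hno⟩ := hS x pre.length s₁ hs₁
      by_cases hSx : S x
      · refine ⟨fun _ => hR.runs ((hyes hSx).mono fun s' t ht => ⟨ht.1, by omega⟩), fun h => ?_⟩
        exact absurd ⟨x, by simp, hcand, hSx⟩ h
      · obtain ⟨j, s₂, t₂, hR₂, h₂, hx₂, ht₂⟩ := hno hSx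
        obtain ⟨s₃, t₃, hrun₃, h₃, ht₃⟩ := searchStep_pop (Q := fun s' t =>
          AtNode n m k w E X St c (pre.length + 1) s' ∧ t ≤ 20) h₂ hx₂
          ((popNode_runs hB hE h₂ hi hc).mono fun s' t ht => fun t' ht' => ⟨ht.1, by omega⟩)
        have ht₃ : t₃ + 1 ≤ stepTime k := by unfold stepTime; omega
        have hR₃ := (hR.trans hR₂).trans (Reaches.step h₂.holds hrun₃)
        obtain ⟨hyes', hno'⟩ := hnext s₃ h₃
        constructor
        · rintro ⟨y, hy, hcy, hSy⟩
          have hy : y ∈ suf := by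
            rcases List.mem_cons.1 hy with rfl | hy
            exacts [absurd hSy hSx, hy]
          refine hR₃.runs ((hyes' ⟨y, hy, hcy, hSy⟩).mono fun s' t ht => ⟨ht.1, ?_⟩)
          have := ht.2
          rw [mul_add] at this ⊢
          omega
        · intro hn
          obtain ⟨j', s₄, t₄, hR₄, h₄, hx₄, ht₄⟩ := hno' fun ⟨y, hy, hcy, hSy⟩ =>
            hn ⟨y, List.mem_cons_of_mem _ hy, hcy, hSy⟩
          refine ⟨j', s₄, _, hR₃.trans hR₄, h₄, hx₄, ?_⟩
          rw [mul_add] at ht₄ ⊢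
          omega
    · rw [if_neg hcand] at hs₁
      simp only [List.length_cons, List.countP_cons, hcand, decide_false, Bool.false_eq_true,
        if_false, add_zero]
      rw [add_mul, one_mul]
      obtain ⟨hyes', hno'⟩ := hnext s₁ hs₁
      constructor
      · rintro ⟨y, hy, hcy, hSy⟩
        have hy : y ∈ suf := by
          rcases List.mem_cons.1 hy with rfl | hy
          exacts [absurd hcy hcand, hy]
        exact hR.runs ((hyes' ⟨y, hy, hcy, hSy⟩).mono fun s' t ht => ⟨ht.1, by omega⟩)
      · intro hn
        obtain ⟨j', s₄, t₄, hR₄, h₄, hx₄, ht₄⟩ := hno' fun ⟨y, hy, hcy, hSy⟩ =>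
          hn ⟨y, List.mem_cons_of_mem _ hy, hcy, hSy⟩
        exact ⟨j', s₄, _, hR.trans hR₄, h₄, hx₄, by omega⟩

theorem visits_leaf (hB : Fits n m k w B) {St : List (Fin n × ℕ)} {c i T : ℕ} {s : State}
    (h0 : remaining E (stackVertices St) = ∅) (h : AtNode n m k w E X St c i s)
    (hT : stepTime k ≤ T) : Visits n m k w B E X St c s (c ≤ w) T := by
  constructor
  · intro hc
    obtain ⟨s', t, hrun, h1, h2, ht⟩ := searchStep_accept hB h h0 hc
    refine (Reaches.step h.holds hrun).runs (Runs.loopStop h2 ⟨h1, ?_⟩)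
    unfold stepTime at hT
    omega
  · exact fun hc => ⟨i, s, 0, .refl, h, Or.inl ⟨h0, not_le.1 hc⟩, Nat.zero_le _⟩

theorem Visits.mono {St : List (Fin n × ℕ)} {c T T' : ℕ} {s : State} {P P' : Prop}
    (h : Visits n m k w B E X St c s P T) (hP : P ↔ P') (hT : T ≤ T') :
    Visits n m k w B E X St c s P' T' := by
  rw [← hP]
  refine ⟨fun hp => (h.1 hp).mono fun s' t ht => ⟨ht.1, ht.2.trans hT⟩, fun hp => ?_⟩
  obtain ⟨i, s', t, h1, h2, h3, h4⟩ := h.2 hp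
  exact ⟨i, s', t, h1, h2, h3, h4.trans hT⟩

theorem countP_candidates_le (hX : X.Nodup) {F : Finset (Sym2 (Fin n))} (hF : F ≠ ∅) (r : ℕ) :
    X.countP (fun x => F.card ≤ r * edgeDegree F x) ≤ 2 * r := by
  rw [List.countP_eq_length_filter, ← List.toFinset_card_of_nodup (hX.filter _)]
  exact card_candidates_le hF r _ (by simp)

/-- The children are handled by the induction hypothesis, and `card_candidates_le` bounds by `2 * (r
+ 1)` how many of them are entered. -/
theorem visits_node (hB : Fits n m k w B) (hE : E.card ≤ m) (r : ℕ) :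
    ∀ (St : List (Fin n × ℕ)) (c : ℕ) (s : State), St.length + r = k →
      AtNode n m k w E X St c 0 s →
      Visits n m k w B E X St c s (Succeeds X w r (remaining E (stackVertices St)) c)
        (nodeTime k X.length r) := by
  induction r with
  | zero =>
    intro St c s hd h
    by_cases h0 : remaining E (stackVertices St) = ∅
    · exact (visits_leaf hB h0 h le_rfl).mono (by simp [Succeeds, h0]) le_rfl
    · exact ⟨fun hs => absurd hs.1 h0, fun _ => ⟨0, s, 0, .refl, h, Or.inr ⟨h0, Or.inl hd⟩, by simp⟩⟩
  | succ r ih =>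
    intro St c s hd h
    by_cases h0 : remaining E (stackVertices St) = ∅
    · exact (visits_leaf hB h0 h (stepTime_le_nodeTime _ _ _)).mono (by simp [Succeeds, h0]) le_rfl
    · have hk : k - St.length = r + 1 := by omega
      refine (visits_children hB hE h0 (by omega) h.cost_le
        (fun x => Succeeds X w r (del (remaining E (stackVertices St)) x)
          (c + (remaining E (stackVertices St)).card))
        (fun x i s' hs' => ih ((x, i) :: St) _ s' (by simp; omega) hs') X [] s rfl h).mono ?_ ?_
      · simp only [Succeeds, h0, false_and, false_or, ne_eq, not_false_eq_true, true_and, hk]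
      · rw [hk, nodeTime]
        exact Nat.add_le_add_left (Nat.mul_le_mul_right _ (countP_candidates_le h.kernel.nodup h0 _)) _

theorem searchLoop_runs (hB : Fits n m k w B) (hE : E.card ≤ m) {s : State}
    (h : AtNode n m k w E X [] 0 0 s) : Runs B searchLoop s fun s' t =>
      ((Succeeds X w k E 0 → s'.reg rN = 1) ∧ (¬ Succeeds X w k E 0 → s'.reg rN = 0)) ∧
        t ≤ nodeTime k X.length k + 8 := by
  obtain ⟨hyes, hno⟩ := visits_node hB hE k [] 0 s (by simp) h
  change Succeeds X w k E 0 → _ at hyes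
  change ¬ Succeeds X w k E 0 → _ at hno
  by_cases hs : Succeeds X w k E 0
  · exact (hyes hs).mono fun s' t ht => ⟨⟨fun _ => ht.1, fun hn => absurd hs hn⟩, by omega⟩
  · obtain ⟨i, s', t, hR, h', hx, ht⟩ := hno hs
    obtain ⟨s'', t', hrun, h1, h2, ht'⟩ := searchStep_reject hB h' hx
    refine (hR.trans (Reaches.step h'.holds hrun)).runs (Runs.loopStop h2 ⟨⟨fun hp => absurd hp hs,
      fun _ => h1⟩, by omega⟩)

theorem nodeTime_le (k q : ℕ) (hq : q ≤ k + k * (k * k + k)) :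
    nodeTime k q k ≤ 580 * (2 ^ k * k.factorial * k ^ 4) + 41 := by
  rcases Nat.eq_zero_or_pos k with rfl | hk
  · simp [nodeTime, stepTime]
  · have h1 : q + 2 ≤ 5 * k ^ 3 := by nlinarith [Nat.mul_le_mul hk hk, pow_pos hk 3, sq_nonneg k]
    have h2 : stepTime k ≤ 58 * k := by unfold stepTime; omega
    have h3 := Nat.mul_le_mul_right (2 * (2 ^ k * k.factorial)) (Nat.mul_le_mul h1 h2)
    calc nodeTime k q k ≤ _ := (Nat.le_add_right _ _).trans ((nodeTime_add_le k q k).trans h3)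
      _ = 580 * (2 ^ k * k.factorial * k ^ 4) := by ring
      _ ≤ _ := Nat.le_add_right _ _

end MinSumVC

/-! ## The algorithm -/

namespace MinSumVC

open RAM

variable {n k w B : ℕ} {l : List (Fin n × Fin n)}

theorem searchPhase_runs (hB : Fits n l.length k w B) {G : SimpleGraph (Fin n)}
    [DecidableRel G.Adj] (hG : edgesOf l = G.edgeFinset) (hcard : G.edgeFinset.card = l.length)
    {X : List (Fin n)} {s : State} (hC : Constants n l.length k w s)
    (hM : GraphMemory l.length (edgesOf l) s) (hF : SearchFresh s)
    (hK : KernelMemory l.length X s) (hX : IsKernel (edgesOf l) (k * k + k) X) :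
    Runs B searchPhase s fun s' t =>
      ((YesInstance G k w → s'.reg rN = 1) ∧ (¬ YesInstance G k w → s'.reg rN = 0)) ∧
        t ≤ 580 * (2 ^ k * k.factorial * k ^ 4) + 60 := by
  rw [hG] at hM hX
  have hlen : X.length ≤ n := by simpa using hK.nodup.length_le_card
  have hcap : k + k * (k * k + k) < B := by
    refine lt_of_le_of_lt ?_ hB.cube
    have hk : k ≤ n + l.length + k + w + 2 := by omega
    have h3 := Nat.pow_le_pow_left hk 3
    have h2 : k ^ 2 ≤ k ^ 3 ∨ k = 0 := by
      rcases Nat.eq_zero_or_pos k with h | h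
      · exact Or.inr h
      · exact Or.inl (Nat.pow_le_pow_right h (by norm_num))
    rcases h2 with h2 | rfl
    · nlinarith [Nat.le_self_pow (n := 3) (by norm_num) k]
    · simp
  have hcap' : k * (k * k + k) < B := lt_of_le_of_lt (Nat.le_add_left _ _) hcap
  simp only [searchPhase, runs_seq, runs_arith, runs_const, runs_copy, runs_ite, Test.Holds,
    Op.eval, State.setReg_reg, hC.maxCost, hC.threshold, hC.edges, hK.count, reduceIte,
    Nat.reduceEqDiff]
  refine ⟨hcap', by rwa [add_comm], fun hlt => ⟨hB.lt_of_le_linear (by omega), ?_, by omega⟩,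
    fun hge => ⟨hB.lt_of_le_linear (by omega), hB.lt_of_le_linear (by omega), ?_⟩⟩
  -- An oversized kernel excludes a yes-instance. The size bound is not needed for the correctness
  -- of the search, only for its time.
  · refine ⟨fun hy => ?_, fun _ => trivial⟩
    have := hy.kernel_length_le G hX hK.nodup
    omega
  · refine Runs.mono (searchLoop_runs (X := X) hB hcard.le ?_) ?_
    · exact
        { constants := by
            constructor <;> simp [hC.vertices, hC.edges, hC.maxCost, hC.totalCost,
              hC.zero, hC.one, hC.eight, hC.base, hC.threshold]
          graph := ⟨hM.degree, hM.adjacency⟩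
          kernel := ⟨by simp [hK.count], hK.list, hK.mark, hK.nodup⟩
          stack := trivial
          depth := by simp [hF.depth]
          edges := by simp [remaining, hcard]
          cost := by simp [hF.cost]
          index := by simp [hF.index]
          run := by simp
          nodup := by simp
          depth_le := by simp
          cost_le := by simp }
    · rintro s' t ⟨h, ht⟩
      rw [hX.succeeds_iff] at h
      have := nodeTime_le k X.length (by omega)
      exact ⟨h, by omega⟩

theorem edgeMemory_inputState (l : List (Fin n × Fin n)) (k w : ℕ) :
    EdgeMemory l (inputState n l k w) := by
  intro i hi
  simp only [inputState]
  induction l generalizing i with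
  | nil => simp at hi
  | cons p l ih =>
    cases i with
    | zero => simp
    | succ i =>
      have := ih i (by simpa using hi)
      simpa [mul_add, List.flatMap_cons] using this

theorem inputState_mem_of_le (l : List (Fin n × Fin n)) (k w : ℕ) {j : ℕ} (hj : 2 * l.length ≤ j) :
    (inputState n l k w).mem j = 0 := by
  simp only [inputState]
  rw [List.getD_eq_default]
  simpa [List.length_flatMap, mul_comm] using hj

theorem program_runs (hB : Fits n l.length k w B) {G : SimpleGraph (Fin n)} [DecidableRel G.Adj]
    (hl : IsEdgeList G l) : Runs B program (inputState n l k w) fun s' t =>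
      ((YesInstance G k w → s'.reg rN = 1) ∧ (¬ YesInstance G k w → s'.reg rN = 0)) ∧
        t ≤ 100 * l.length + 580 * (2 ^ k * k.factorial * k ^ 4) + 100 := by
  obtain ⟨hnd, hmem⟩ := hl
  have hE : edgesOf l = G.edgeFinset := by
    ext e; rw [edgesOf, List.mem_toFinset, hmem, SimpleGraph.mem_edgeFinset]
  have hcard : G.edgeFinset.card = l.length := by
    rw [← hE, edgesOf, List.toFinset_card_of_nodup hnd, List.length_map]
  have hne : ∀ p ∈ l, p.1 ≠ p.2 := by
    intro p hp
    have := (hmem s(p.1, p.2)).1 (List.mem_map.2 ⟨p, hp, rfl⟩)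
    exact G.ne_of_adj this
  have hsq : k * k + k < B := by
    refine hB.lt_of_le ?_
    have : (k + 1) * (k + 1) ≤ (n + l.length + k + w + 2) ^ 2 := by
      rw [sq]; exact Nat.mul_le_mul (by omega) (by omega)
    nlinarith
  have h8 : 8 < B := by
    have : 2 ^ 2 ≤ (n + l.length + k + w + 2) ^ 2 := Nat.pow_le_pow_left (by omega) 2
    exact hB.lt_of_le (by omega)
  have hsq' : k * k < B := by omega
  -- All arrays lie behind the input and start at zero, so the empty graph and the empty kernel are
  -- already represented and no time depending on `n` is spent.
  have hcell : ∀ t j, (inputState n l k w).mem (cell l.length t j) = 0 := fun t j =>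
    inputState_mem_of_le l k w (by unfold cell; omega)
  have hM := edgeMemory_inputState l k w
  obtain ⟨s₀, hs₀⟩ : ∃ s, s = inputState n l k w := ⟨_, rfl⟩
  have hreg : ∀ x, s₀.reg x = [n, l.length, k, w].getD x 0 := fun x => by rw [hs₀]; rfl
  rw [← hs₀] at hcell hM ⊢
  clear hs₀
  simp only [program, setConstants, runs_seq, runs_arith, runs_const, Op.eval, State.setReg_reg,
    reduceIte, Nat.reduceEqDiff]
  simp only [hreg, List.getD_cons_zero, List.getD_cons_succ]
  and_intros
  any_goals first
    | exact hB.lt_of_le_linear (by omega)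
    | exact h8
    | exact hsq
    | exact hsq'
  refine Runs.mono (degreeLoop_runs hB hnd hne l [] _ rfl ?_ hM ?_ ?_ ?_) ?_
  · constructor <;> simp [hreg, two_mul]
  · constructor <;> simp [hcell, edgesOf]
  · constructor <;> simp [hreg, hcell]
  · simp [hreg]
  rintro s₁ t₁ ⟨⟨hC₁, hM₁, hG₁, hF₁⟩, ht₁⟩
  refine ⟨hB.lt_of_le_linear (by omega), ?_⟩
  refine Runs.mono (kernelLoop_runs hB l [] (s₁.setReg rI 0) [] rfl ?_ hM₁
    ⟨hG₁.degree, hG₁.adjacency⟩ ?_ ?_ ?_ ?_) ?_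
  · constructor <;> simp [hC₁.vertices, hC₁.edges, hC₁.maxCost, hC₁.totalCost, hC₁.zero, hC₁.one,
      hC₁.eight, hC₁.base, hC₁.threshold]
  · constructor <;> simp [hF₁.depth, hF₁.cost, hF₁.index]
  · constructor <;> simp [hF₁.count, hF₁.mark]
  · simp [edgesOf]
  · simp
  rintro s₂ t₂ ⟨⟨hC₂, hG₂, hF₂, X, hK, hX⟩, ht₂⟩
  refine (searchPhase_runs hB hE hcard hC₂ hG₂ hF₂ hK hX).mono ?_
  rintro s₃ t₃ ⟨h, ht₃⟩
  exact ⟨h, by omega⟩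

end MinSumVC

theorem theorem2 :
    ∃ (P : RAM.Prog) (a C : ℕ),
      ∀ (n : ℕ) (G : SimpleGraph (Fin n)) [DecidableRel G.Adj] (k w : ℕ)
        (l : List (Fin n × Fin n)), MinSumVC.IsEdgeList G l →
        ∃ (s : RAM.State) (t : ℕ),
          RAM.Exec ((n + G.edgeFinset.card + k + w + 2) ^ a) P
            (MinSumVC.inputState n l k w) s t ∧
          t ≤ C * (G.edgeFinset.card + 2 ^ k * k.factorial * k ^ 4 + 1) ∧
          (MinSumVC.YesInstance G k w → s.reg 0 = 1) ∧
          (¬ MinSumVC.YesInstance G k w → s.reg 0 = 0) := by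
  -- The exponent `8` comes from `fits`, and `1000` exceeds the constants `100`, `580` and `100` of
  -- `program_runs`.
  refine ⟨MinSumVC.program, 8, 1000, fun n G _ k w l hl => ?_⟩
  have hcard : G.edgeFinset.card = l.length := by
    rw [← List.length_map (as := l) (fun p => s(p.1, p.2)), ← List.toFinset_card_of_nodup hl.1]
    congr 1
    ext e
    rw [List.mem_toFinset, hl.2, SimpleGraph.mem_edgeFinset]
  rw [hcard]
  obtain ⟨s, t, hrun, h, ht⟩ := MinSumVC.program_runs (MinSumVC.fits n l.length k w) hl
  exact ⟨s, t, hrun, by omega, h⟩
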